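/- Let $k$ be a field, $H$ a Hopf algebra over $k$ with bijective antipode $S$, $J\subseteq H$ a Hopf ideal, $H_0=H/J$ with quotient map $\mathrm{pr}_0:H\to H_0$, and $$K={}^{\mathrm{co}H_0}H=\{x\in H:\ \mathrm{pr}_0(x_{(1)})\otimes x_{(2)}=1\otimes x\}.$$ A right $H$-comodule algebra $A$ with coinvariants $B=A^{\mathrm{co}H}$ is called principal if the canonical map $\chi: A\otimes_BA\to A\otimes H$, $a'\otimes a\mapsto a'a_{(0)}\otimes a_{(1)}$, is bijective and $A$ is a faithfully flat left $B$-module. Assume that $H$ is a principal left $H_0$-comodule algebra under $(\mathrm{pr}_0\otimes\mathrm{id})\circ\Delta$, i.e. $H\otimes_KH\to H_0\otimes H$, $h\otimes h'\mapsto \mathrm{pr}_0(h_{(1)})\otimes h_{(2)}h'$, is bijective and $H$ is a faithfully flat left $K$-module. Let $(M,\mathcal O_M)$ be a quantum ringed space (a topological space with a sheaf of not necessarily commutative $k$-algebras). A quantum $H$-principal bundle over it with respect to an open covering $\{U_i\}$ is a sheaf $\mathcal F$ of $H$-comodule algebras on $M$ with a morphism of sheaves of algebras $\iota:\mathcal O_M\to\mathcal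 F$ taking values in coinvariants, such that for every $i$ the map $\iota_{U_i}$ is an isomorphism $\mathcal O_M(U_i)\cong\mathcal F(U_i)^{\mathrm{co}H}$ and $\mathcal F(U_i)$ is a principal $H$-comodule algebra. (Likewise for $H_0$.) Given such an $\mathcal F$, an algebraic reduction of $\mathcal F$ to $H_0$ with respect to $\{U_i\}$ is a quantum $H_0$-principal bundle $\mathcal F_0$ over $(M,\mathcal O_M)$ with respect to the same covering, together with a morphism $\varphi:\mathcal F\to\mathcal F_0$ of sheaves of $H_0$-comodule algebras (for the induced coaction $(\mathrm{id}\otimes \mathrm{pr}_0)\circ\delta$ on $\mathcal F$), such that $\varphi(\mathcal F(U_i)^{\mathrm{co}H})=\mathcal F_0(U_i)^{\mathrm{co}H_0}$ for all $i$. Let $\mathcal F$ be a quantum $H$-principal bundle over $(M,\mathcal O_M)$ with respect to a finite open covering $\{U_i\}$ that generates the topology of $M$, and suppose that every nonempty $U_i$ is the smallest open neighbourhood of one of its points, i.e. there is $x\in U_i$ such that $U_i\subseteq U_j$ whenever $x\in U_j$ (this is automatic if no $U_i$ is contained in the union of the others). Let $$f_i: K\longrightarrow Z_{\mathcal F(U_i)}(\mathcal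 O_M(U_i))$$ be algebra maps into the centralizers of $\mathcal O_M(U_i)=\mathcal F(U_i)^{\mathrm{co}H}$ in $\mathcal F(U_i)$ that are maps of right $H$-comodules ($f_i(x)_{(0)}\otimes f_i(x)_{(1)}=f_i(x_{(1)})\otimes x_{(2)}$) and of right $H$-modules for the adjoint action on $K$ and the Miyashita–Ulbrich action on the centralizer ($f_i(S(h_{(1)})xh_{(2)})=\sum_r t_r\,f_i(x)\,t'_r$, where $\sum_r t_r\otimes t'_r=\chi^{-1}(1\otimes h)$), for all $x\in K$, $h\in H$. Assume that $f_i(x)|_{U_i\cap U_j}=f_j(x)|_{U_i\cap U_j}$ for all $i,j$ and $x\in K$. Then $\mathcal F$ has an algebraic reduction $\varphi:\mathcal F\to\mathcal F_0$ to $H_0$ with respect to $\{U_i\}$, which is compatible with the maps from $\mathcal O_M$ and is the quotient of $\mathcal F$ by the ideal sheaf locally generated by the sets $f_i(K\cap\ker\varepsilon)$: the sheaf morphism $\varphi$ is locally surjective, and its kernel consists of the sections that locally belong to the two-sided ideal generated by the restrictions of the elements of $f_i(K\cap\ker\varepsilon)$. Moreover, for every $i$, $\varphi_{U_i}$ is surjective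 with kernel the left ideal $\mathcal F(U_i)f_i(K\cap\ker\varepsilon)$, so that $\mathcal F_0(U_i)\cong\mathcal F(U_i)/\mathcal F(U_i)f_i(K\cap\ker\varepsilon)$. -/

import Mathlib

open CategoryTheory TopologicalSpace Opposite
open scoped TensorProduct

universe u

namespace QuantumBundle

noncomputable section

/-! ## Tensor products over noncommutative rings and faithful flatness -/

section BalancedTensor

/-- The subgroup of `N ⊗ P` generated by the elements `nb ⊗ p - n ⊗ bp`. -/
def balancedRelations (B : Type*) [Ring B] (N P : Type*) [AddCommGroup N] [Module Bᵐᵒᵖ N]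
    [AddCommGroup P] [Module B P] : AddSubgroup (N ⊗[ℤ] P) :=
  AddSubgroup.closure
    {t | ∃ (n : N) (b : B) (p : P), t = (MulOpposite.op b • n) ⊗ₜ[ℤ] p - n ⊗ₜ[ℤ] (b • p)}

/-- The tensor product `N ⊗_B P` of a right module `N` and a left module `P` over a
(noncommutative) ring `B`. -/
abbrev BalancedTensor (B : Type*) [Ring B] (N P : Type*) [AddCommGroup N] [Module Bᵐᵒᵖ N]
    [AddCommGroup P] [Module B P] : Type _ :=
  (N ⊗[ℤ] P) ⧸ balancedRelations B N P

variable {B : Type*} [Ring B] {N N' P G : Type*} [AddCommGroup N] [Module Bᵐᵒᵖ N]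
  [AddCommGroup N'] [Module Bᵐᵒᵖ N'] [AddCommGroup P] [Module B P] [AddCommGroup G]

/-- The class of `n ⊗ p` in `N ⊗_B P`. -/
def BalancedTensor.tmul (B : Type*) [Ring B] [Module Bᵐᵒᵖ N] [Module B P] (n : N) (p : P) :
    BalancedTensor B N P :=
  QuotientAddGroup.mk (n ⊗ₜ[ℤ] p)

/-- The universal property of `N ⊗_B P`. -/
def BalancedTensor.lift (f : N →+ P →+ G)
    (hf : ∀ (n : N) (b : B) (p : P), f (MulOpposite.op b • n) p = f n (b • p)) :
    BalancedTensor B N P →+ G :=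
  QuotientAddGroup.lift (balancedRelations B N P)
    (TensorProduct.liftAddHom f fun r n p => by simp) <| by
      rw [balancedRelations, AddSubgroup.closure_le]
      rintro _ ⟨n, b, p, rfl⟩
      simp [hf]

theorem BalancedTensor.lift_tmul (f : N →+ P →+ G)
    (hf : ∀ (n : N) (b : B) (p : P), f (MulOpposite.op b • n) p = f n (b • p)) (n : N) (p : P) :
    BalancedTensor.lift f hf (BalancedTensor.tmul B n p) = f n p := rfl

/-- The map `g ⊗_B P : N ⊗_B P → N' ⊗_B P` induced by a map `g : N → N'` of right modules. -/
def BalancedTensor.map (P : Type*) [AddCommGroup P] [Module B P] (g : N →ₗ[Bᵐᵒᵖ] N') :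
    BalancedTensor B N P →+ BalancedTensor B N' P :=
  QuotientAddGroup.map (balancedRelations B N P) (balancedRelations B N' P)
    (TensorProduct.map g.toAddMonoidHom.toIntLinearMap
      (LinearMap.id : P →ₗ[ℤ] P)).toAddMonoidHom <| by
      rw [balancedRelations, AddSubgroup.closure_le]
      rintro _ ⟨n, b, p, rfl⟩
      refine AddSubgroup.subset_closure ⟨g n, b, p, ?_⟩
      simp

theorem BalancedTensor.map_tmul (g : N →ₗ[Bᵐᵒᵖ] N') (n : N) (p : P) :
    BalancedTensor.map P g (BalancedTensor.tmul B n p) = BalancedTensor.tmul B (g n) p := rfl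

end BalancedTensor

/-- A left `B`-module `P` is faithfully flat: a sequence of right `B`-modules is exact if and only
if it is exact after applying `- ⊗_B P`. -/
def FaithfullyFlat (B P : Type u) [Ring B] [AddCommGroup P] [Module B P] : Prop :=
  ∀ (N₁ N₂ N₃ : Type u) [AddCommGroup N₁] [AddCommGroup N₂] [AddCommGroup N₃]
    [Module Bᵐᵒᵖ N₁] [Module Bᵐᵒᵖ N₂] [Module Bᵐᵒᵖ N₃]
    (f : N₁ →ₗ[Bᵐᵒᵖ] N₂) (g : N₂ →ₗ[Bᵐᵒᵖ] N₃),
    Function.Exact f g ↔ Function.Exact (BalancedTensor.map P f) (BalancedTensor.map P g)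

/-- An algebra as a right module over a subalgebra, by right multiplication. -/
instance rightModule {k A : Type*} [CommRing k] [Ring A] [Algebra k A] (B : Subalgebra k A) :
    Module (↥B)ᵐᵒᵖ A :=
  Module.compHom A (RingHom.op (B.val : B →+* A))

theorem op_smul_eq {k A : Type*} [CommRing k] [Ring A] [Algebra k A] (B : Subalgebra k A)
    (b : B) (a : A) : MulOpposite.op b • a = a * (b : A) := rfl

/-! ## Comodule algebras and Hopf-Galois extensions -/

section Right

variable {k H A : Type u} [Field k] [Ring H] [HopfAlgebra k H] [Ring A] [Algebra k A]

/-- The algebra map `ρ : A → A ⊗ H` is a right `H`-coaction, making `A` a right `H`-comodule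
algebra. -/
structure IsRightCoaction (ρ : A →ₐ[k] A ⊗[k] H) : Prop where
  coassoc : ∀ a : A,
    TensorProduct.assoc k A H H (TensorProduct.map ρ.toLinearMap LinearMap.id (ρ a)) =
      TensorProduct.map LinearMap.id Coalgebra.comul (ρ a)
  counit : ∀ a : A,
    TensorProduct.map LinearMap.id Coalgebra.counit (ρ a) = a ⊗ₜ[k] (1 : k)

/-- The coinvariants `{a | ρ a = a ⊗ 1}`. -/
def coinvariants (ρ : A →ₐ[k] A ⊗[k] H) : Subalgebra k A :=
  AlgHom.equalizer ρ Algebra.TensorProduct.includeLeft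

theorem mem_coinvariants (ρ : A →ₐ[k] A ⊗[k] H) (a : A) :
    a ∈ coinvariants ρ ↔ ρ a = a ⊗ₜ[k] (1 : H) := Iff.rfl

/-- The canonical map `A ⊗_B A → A ⊗ H`, `a' ⊗ a ↦ a' a₍₀₎ ⊗ a₍₁₎ = (a' ⊗ 1) ρ(a)`, where `B` is
the algebra of coinvariants. -/
def canonicalMap (ρ : A →ₐ[k] A ⊗[k] H) :
    BalancedTensor (coinvariants ρ) A A →+ A ⊗[k] H :=
  BalancedTensor.lift
    ((AddMonoidHom.compl₂ (AddMonoidHom.mul (R := A ⊗[k] H)) (ρ : A →+ A ⊗[k] H)).comp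
      ((Algebra.TensorProduct.includeLeft : A →ₐ[k] A ⊗[k] H) : A →+ A ⊗[k] H)) <| by
    intro a' b a
    have hb : ρ (b : A) = (b : A) ⊗ₜ[k] (1 : H) := b.2
    simp [op_smul_eq, Subalgebra.smul_def, hb, ← mul_assoc]

theorem canonicalMap_tmul (ρ : A →ₐ[k] A ⊗[k] H) (a' a : A) :
    canonicalMap ρ (BalancedTensor.tmul _ a' a) = (a' ⊗ₜ[k] (1 : H)) * ρ a := rfl

/-- A principal right `H`-comodule algebra: a Hopf-Galois extension of its coinvariants `B` that is
faithfully flat as a left `B`-module. -/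
structure IsPrincipal (ρ : A →ₐ[k] A ⊗[k] H) : Prop where
  coaction : IsRightCoaction ρ
  galois : Function.Bijective (canonicalMap ρ)
  flat : FaithfullyFlat (coinvariants ρ) A

/-- The translation map `τ(h) = χ⁻¹(1 ⊗ h)` of a Hopf-Galois extension. -/
def translationMap (ρ : A →ₐ[k] A ⊗[k] H) (hρ : Function.Bijective (canonicalMap ρ)) (h : H) :
    BalancedTensor (coinvariants ρ) A A :=
  (Equiv.ofBijective _ hρ).symm ((1 : A) ⊗ₜ[k] h)

/-- The centralizer `Z_A(B)` of the coinvariants `B` in `A`. -/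
abbrev coinvariantCentralizer (ρ : A →ₐ[k] A ⊗[k] H) : Subalgebra k A :=
  Subalgebra.centralizer k (coinvariants ρ : Set A)

/-- For `x` centralizing the coinvariants `B`, the map `A ⊗_B A → A`, `a ⊗ a' ↦ a x a'`. -/
def sandwich (ρ : A →ₐ[k] A ⊗[k] H) (x : coinvariantCentralizer ρ) :
    BalancedTensor (coinvariants ρ) A A →+ A :=
  BalancedTensor.lift
    ((AddMonoidHom.mul (R := A)).comp (AddMonoidHom.mulRight (x : A))) <| by
    intro a b a'
    have hx : (b : A) * (x : A) = (x : A) * (b : A) :=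
      (Subalgebra.mem_centralizer_iff k).1 x.2 b b.2
    simp [op_smul_eq, Subalgebra.smul_def, mul_assoc]
    simp [← mul_assoc, hx]

theorem sandwich_tmul (ρ : A →ₐ[k] A ⊗[k] H) (x : coinvariantCentralizer ρ) (a a' : A) :
    sandwich ρ x (BalancedTensor.tmul _ a a') = a * x * a' := rfl

/-- The Miyashita-Ulbrich action `x ◁ h = τ(h)⁽¹⁾ x τ(h)⁽²⁾` of `H` on `Z_A(B)`. -/
def miyashitaUlbrich (ρ : A →ₐ[k] A ⊗[k] H) (hρ : Function.Bijective (canonicalMap ρ))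
    (x : coinvariantCentralizer ρ) (h : H) : A :=
  sandwich ρ x (translationMap ρ hρ h)

end Right

section Left

variable {k C A : Type u} [Field k] [Ring C] [HopfAlgebra k C] [Ring A] [Algebra k A]

/-- The algebra map `l : A → C ⊗ A` is a left `C`-coaction, making `A` a left `C`-comodule
algebra. -/
structure IsLeftCoaction (l : A →ₐ[k] C ⊗[k] A) : Prop where
  coassoc : ∀ a : A,
    TensorProduct.assoc k C C A (TensorProduct.map Coalgebra.comul LinearMap.id (l a)) =
      TensorProduct.map LinearMap.id l.toLinearMap (l a)
  counit : ∀ a : A,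
    TensorProduct.map Coalgebra.counit LinearMap.id (l a) = (1 : k) ⊗ₜ[k] a

/-- The left coinvariants `{a | l a = 1 ⊗ a}`. -/
def leftCoinvariants (l : A →ₐ[k] C ⊗[k] A) : Subalgebra k A :=
  AlgHom.equalizer l Algebra.TensorProduct.includeRight

theorem mem_leftCoinvariants (l : A →ₐ[k] C ⊗[k] A) (a : A) :
    a ∈ leftCoinvariants l ↔ l a = (1 : C) ⊗ₜ[k] a := Iff.rfl

/-- The canonical map `A ⊗_K A → C ⊗ A`, `a ⊗ a' ↦ a₍₋₁₎ ⊗ a₍₀₎ a' = l(a) (1 ⊗ a')`, of a left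
`C`-comodule algebra, where `K` is the algebra of left coinvariants. -/
def leftCanonicalMap (l : A →ₐ[k] C ⊗[k] A) :
    BalancedTensor (leftCoinvariants l) A A →+ C ⊗[k] A :=
  BalancedTensor.lift
    ((AddMonoidHom.compl₂ (AddMonoidHom.mul (R := C ⊗[k] A))
      ((Algebra.TensorProduct.includeRight : A →ₐ[k] C ⊗[k] A) : A →+ C ⊗[k] A)).comp
      (l : A →+ C ⊗[k] A)) <| by
    intro a b a'
    have hb : l (b : A) = (1 : C) ⊗ₜ[k] (b : A) := b.2
    simp [op_smul_eq, Subalgebra.smul_def, hb, mul_assoc]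

theorem leftCanonicalMap_tmul (l : A →ₐ[k] C ⊗[k] A) (a a' : A) :
    leftCanonicalMap l (BalancedTensor.tmul _ a a') = l a * ((1 : C) ⊗ₜ[k] a') := rfl

/-- A principal left `C`-comodule algebra. -/
structure IsLeftPrincipal (l : A →ₐ[k] C ⊗[k] A) : Prop where
  coaction : IsLeftCoaction l
  galois : Function.Bijective (leftCanonicalMap l)
  flat : FaithfullyFlat (leftCoinvariants l) A

end Left

/-! ## The coinvariants of `H` under a quotient Hopf algebra `H ⧸ J` -/

section Quotient

variable (k : Type u) {H : Type u} [Field k] [Ring H] [HopfAlgebra k H]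
  (J : Ideal H) [J.IsTwoSided] [J.IsHopfIdeal k]

/-- The left coaction `(pr₀ ⊗ id) ∘ Δ` of `H₀ = H ⧸ J` on `H`. -/
def quotientCoaction : H →ₐ[k] (H ⧸ J) ⊗[k] H :=
  (Algebra.TensorProduct.map (Ideal.Quotient.mkₐ k J) (AlgHom.id k H)).comp
    (Bialgebra.comulAlgHom k H)

/-- The algebra `K` of coinvariants of `H` under the left coaction of `H₀ = H ⧸ J`. -/
abbrev coinvH : Subalgebra k H := leftCoinvariants (quotientCoaction k J)

variable {J}

/-- The right adjoint action `x ◁ h = S(h₍₁₎) x h₍₂₎` on `H`, as a linear map in `h`. -/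
def adjointMap (x : H) : H →ₗ[k] H :=
  LinearMap.mul' k H ∘ₗ
    TensorProduct.map (HopfAlgebra.antipode k) (LinearMap.mulLeft k x) ∘ₗ Coalgebra.comul

theorem adjointMap_mem {x : H} (hx : x ∈ coinvH k J) (h : H) :
    adjointMap k x h ∈ coinvH k J := by
  let q : H →ₐ[k] (H ⧸ J) ⊗[k] H := quotientCoaction k J
  let p : H →ₐ[k] (H ⧸ J) ⊗[k] H := Algebra.TensorProduct.includeLeft.comp (Ideal.Quotient.mkₐ k J)
  let r : H →ₐ[k] (H ⧸ J) ⊗[k] H := Algebra.TensorProduct.includeRight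
  let S : H →ₗ[k] H := HopfAlgebra.antipode k
  -- convolution products of linear maps `H → H₀ ⊗ H`
  have key : ∀ g : H →ₐ[k] (H ⧸ J) ⊗[k] H,
      WithConv.toConv (g.toLinearMap ∘ₗ S) * WithConv.toConv g.toLinearMap = 1 ∧
      WithConv.toConv g.toLinearMap * WithConv.toConv (g.toLinearMap ∘ₗ S) = 1 := by
    intro g
    constructor
    · ext c
      rw [(Coalgebra.Repr.arbitrary k c).convMul_apply]
      simp only [S, LinearMap.comp_apply, AlgHom.toLinearMap_apply,
        ← map_mul, ← map_sum, HopfAlgebra.sum_antipode_mul_eq_algebraMap_counit]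
      simp
    · ext c
      rw [(Coalgebra.Repr.arbitrary k c).convMul_apply]
      simp only [S, LinearMap.comp_apply, AlgHom.toLinearMap_apply,
        ← map_mul, ← map_sum, HopfAlgebra.sum_mul_antipode_eq_algebraMap_counit]
      simp
  have hq : WithConv.toConv q.toLinearMap =
      WithConv.toConv p.toLinearMap * WithConv.toConv r.toLinearMap := by
    ext c
    rw [(Coalgebra.Repr.arbitrary k c).convMul_apply]
    simp only [q, p, r, quotientCoaction, AlgHom.comp_apply, AlgHom.toLinearMap_apply,
      Bialgebra.comulAlgHom_apply]
    conv_lhs => rw [← (Coalgebra.Repr.arbitrary k c).eq]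
    simp
  have hqS : WithConv.toConv (q.toLinearMap ∘ₗ S) =
      WithConv.toConv (r.toLinearMap ∘ₗ S) * WithConv.toConv (p.toLinearMap ∘ₗ S) := by
    refine left_inv_eq_right_inv (key q).1 ?_
    rw [hq, mul_assoc, ← mul_assoc (WithConv.toConv r.toLinearMap), (key r).2, one_mul,
      (key p).2]
  have hcomm : WithConv.toConv (LinearMap.mulLeft k (r x) ∘ₗ q.toLinearMap) =
      WithConv.toConv p.toLinearMap *
        WithConv.toConv (LinearMap.mulLeft k (r x) ∘ₗ r.toLinearMap) := by
    ext c
    have h1 := congrArg (fun z => r x * z.ofConv c) hq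
    simp only [(Coalgebra.Repr.arbitrary k c).convMul_apply] at h1 ⊢
    simp only [LinearMap.comp_apply, LinearMap.mulLeft_apply] at h1 ⊢
    rw [h1, Finset.mul_sum]
    refine Finset.sum_congr rfl fun i _ => ?_
    simp [p, r]
  have hmain : WithConv.toConv (q.toLinearMap ∘ₗ S) *
      WithConv.toConv (LinearMap.mulLeft k (r x) ∘ₗ q.toLinearMap) =
      WithConv.toConv (r.toLinearMap ∘ₗ S) *
        WithConv.toConv (LinearMap.mulLeft k (r x) ∘ₗ r.toLinearMap) := by
    rw [hqS, hcomm, mul_assoc, ← mul_assoc (WithConv.toConv (p.toLinearMap ∘ₗ S)),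
      (key p).1, one_mul]
  have hx' : q x = r x := hx
  have hadj : adjointMap k x h = ∑ i ∈ (Coalgebra.Repr.arbitrary k h).index,
      S ((Coalgebra.Repr.arbitrary k h).left i) *
        (x * (Coalgebra.Repr.arbitrary k h).right i) := by
    simp only [adjointMap, LinearMap.comp_apply]
    conv_lhs => rw [← (Coalgebra.Repr.arbitrary k h).eq]
    simp [S]
  have h2 := congrArg (fun z => z.ofConv h) hmain
  simp only [(Coalgebra.Repr.arbitrary k h).convMul_apply] at h2
  simp only [LinearMap.comp_apply, LinearMap.mulLeft_apply,
    AlgHom.toLinearMap_apply, ← map_mul, ← map_sum, ← hx'] at h2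
  simp only [hx', ← map_mul, ← map_sum] at h2
  change q (adjointMap k x h) = r (adjointMap k x h)
  rw [hadj, ← h2]

/-- The right adjoint action of `H` on the coinvariants. -/
def adjointAction (x : coinvH k J) (h : H) : coinvH k J :=
  ⟨adjointMap k (x : H) h, adjointMap_mem k x.2 h⟩

variable (J)

/-- The inclusion of `K ⊗ H` in `H ⊗ H`. -/
def inclTensor : (coinvH k J) ⊗[k] H →ₗ[k] H ⊗[k] H :=
  TensorProduct.map (coinvH k J).val.toLinearMap LinearMap.id

theorem inclTensor_injective : Function.Injective (inclTensor k J) :=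
  Module.Flat.rTensor_preserves_injective_linearMap (M := H) (coinvH k J).val.toLinearMap
    Subtype.val_injective

theorem comul_mem_range (x : coinvH k J) :
    (Coalgebra.comul (R := k) (x : H)) ∈ LinearMap.range (inclTensor k J) := by
  let q : H →ₗ[k] (H ⧸ J) ⊗[k] H := (quotientCoaction k J).toLinearMap
  let r : H →ₗ[k] (H ⧸ J) ⊗[k] H := TensorProduct.mk k (H ⧸ J) H 1
  have hex : Function.Exact (coinvH k J).val.toLinearMap (q - r) := by
    intro y
    rw [LinearMap.sub_apply, sub_eq_zero]
    constructor
    · intro hy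
      exact ⟨⟨y, hy⟩, rfl⟩
    · rintro ⟨y, rfl⟩
      exact y.2
  have hex' := Module.Flat.rTensor_exact H hex
  refine (hex' _).1 ?_
  have hsub : ∀ t : H ⊗[k] H, (q - r).rTensor H t = q.rTensor H t - r.rTensor H t := by
    intro t
    rw [LinearMap.rTensor_sub]
    rfl
  rw [hsub, sub_eq_zero]
  have hx : q (x : H) = (1 : H ⧸ J) ⊗ₜ[k] (x : H) := x.2
  have e1 : ∀ t : H ⊗[k] H, TensorProduct.assoc k (H ⧸ J) H H (r.rTensor H t) =
      (1 : H ⧸ J) ⊗ₜ[k] t := by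
    intro t
    induction t with
    | zero => simp
    | tmul a b => simp [r]
    | add a b ha hb => rw [map_add, map_add, ha, hb, TensorProduct.tmul_add]
  have e2 : TensorProduct.assoc k (H ⧸ J) H H (q.rTensor H (Coalgebra.comul (R := k) (x : H))) =
      LinearMap.lTensor (H ⧸ J) (Coalgebra.comul (R := k)) (q (x : H)) := by
    let pr : H →ₗ[k] H ⧸ J := (Ideal.Quotient.mkₐ k J).toLinearMap
    have hq : q = pr.rTensor H ∘ₗ Coalgebra.comul := rfl
    have e3 : ∀ t : (H ⊗[k] H) ⊗[k] H,
        TensorProduct.assoc k (H ⧸ J) H H ((pr.rTensor H).rTensor H t) =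
          pr.rTensor (H ⊗[k] H) (TensorProduct.assoc k H H H t) := by
      intro t
      have : (TensorProduct.assoc k (H ⧸ J) H H).toLinearMap ∘ₗ (pr.rTensor H).rTensor H =
          pr.rTensor (H ⊗[k] H) ∘ₗ (TensorProduct.assoc k H H H).toLinearMap := by
        ext a b c
        simp
      exact LinearMap.congr_fun this t
    have e4 : ∀ t : H ⊗[k] H,
        pr.rTensor (H ⊗[k] H) (LinearMap.lTensor H (Coalgebra.comul (R := k)) t) =
          LinearMap.lTensor (H ⧸ J) (Coalgebra.comul (R := k)) (pr.rTensor H t) := by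
      intro t
      induction t with
      | zero => simp
      | tmul a b => simp
      | add a b ha hb => simp only [map_add, ha, hb]
    rw [hq, LinearMap.rTensor_comp, LinearMap.comp_apply, e3, Coalgebra.coassoc_apply,
      LinearMap.comp_apply, e4]
  apply (TensorProduct.assoc k (H ⧸ J) H H).injective
  rw [e1, e2, hx, LinearMap.lTensor_tmul]

/-- The right `H`-coaction on the coinvariants obtained by restricting the comultiplication of
`H`. -/
def coinvCoaction : coinvH k J →ₗ[k] (coinvH k J) ⊗[k] H :=
  (LinearEquiv.ofInjective (inclTensor k J) (inclTensor_injective k J)).symm.toLinearMap ∘ₗ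
    LinearMap.codRestrict (LinearMap.range (inclTensor k J))
      (Coalgebra.comul ∘ₗ (coinvH k J).val.toLinearMap) (comul_mem_range k J)

theorem inclTensor_coinvCoaction (x : coinvH k J) :
    inclTensor k J (coinvCoaction k J x) = Coalgebra.comul (x : H) :=
  congrArg Subtype.val ((LinearEquiv.ofInjective (inclTensor k J)
    (inclTensor_injective k J)).apply_symm_apply
      ⟨Coalgebra.comul (x : H), comul_mem_range k J x⟩)

end Quotient

/-- A map of right `H`-module and right `H`-comodule algebras from the coinvariants `K` of `H` to
the centralizer `Z_A(B)`, for the adjoint action and the restricted comultiplication on `K`, and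
the Miyashita-Ulbrich action and the restricted coaction on `Z_A(B)`. -/
structure IsModuleComoduleMap {k H A : Type u} [Field k] [Ring H] [HopfAlgebra k H]
    (J : Ideal H) [J.IsTwoSided] [J.IsHopfIdeal k] [Ring A] [Algebra k A]
    (ρ : A →ₐ[k] A ⊗[k] H) (hρ : Function.Bijective (canonicalMap ρ))
    (f : coinvH k J →ₐ[k] coinvariantCentralizer ρ) : Prop where
  map_action : ∀ (x : coinvH k J) (h : H),
    (f (adjointAction k x h) : A) = miyashitaUlbrich ρ hρ (f x) h
  map_coaction : ∀ x : coinvH k J,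
    ρ (f x : A) =
      TensorProduct.map ((coinvariantCentralizer ρ).val.comp f).toLinearMap LinearMap.id
        (coinvCoaction k J x)

/-- The image `f(K ∩ ker ε)`, as a subset of `A`. -/
def augmentationImage {k H A : Type u} [Field k] [Ring H] [HopfAlgebra k H]
    {J : Ideal H} [J.IsTwoSided] [J.IsHopfIdeal k] [Ring A] [Algebra k A]
    {ρ : A →ₐ[k] A ⊗[k] H} (f : coinvH k J →ₐ[k] coinvariantCentralizer ρ) : Set A :=
  {a | ∃ x : coinvH k J, Coalgebra.counit (R := k) (x : H) = 0 ∧ (f x : A) = a}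

/-! ## Sheaves of comodule algebras, quantum principal bundles and reductions -/

section Sheaves

variable {k : Type u} [Field k] {M : TopCat.{u}}

/-- Restriction of sections of a sheaf of algebras. -/
def res (F : TopCat.Sheaf (AlgCat.{u} k) M) {V U : Opens M} (h : V ≤ U) :
    F.presheaf.obj (op U) →ₐ[k] F.presheaf.obj (op V) :=
  (F.presheaf.map (homOfLE h).op).hom

/-- The map on sections over `U` of a morphism of sheaves of algebras. -/
def appHom {F G : TopCat.Sheaf (AlgCat.{u} k) M} (φ : F ⟶ G) (U : Opens M) :
    F.presheaf.obj (op U) →ₐ[k] G.presheaf.obj (op U) :=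
  (φ.hom.app (op U)).hom

variable (k) in
/-- A sheaf of right `H`-comodule algebras. -/
structure ComoduleAlgebraSheaf (H : Type u) [Ring H] [HopfAlgebra k H] (M : TopCat.{u}) where
  /-- the underlying sheaf of algebras -/
  sheaf : TopCat.Sheaf (AlgCat.{u} k) M
  /-- the coaction on sections -/
  coact : ∀ U : Opens M, sheaf.presheaf.obj (op U) →ₐ[k] sheaf.presheaf.obj (op U) ⊗[k] H
  isCoaction : ∀ U, IsRightCoaction (coact U)
  res_coact : ∀ {V U : Opens M} (h : V ≤ U) (a : sheaf.presheaf.obj (op U)),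
    coact V (res sheaf h a) =
      Algebra.TensorProduct.map (res sheaf h) (AlgHom.id k H) (coact U a)

variable {H : Type u} [Ring H] [HopfAlgebra k H]

/-- The sheaf `F` of `H`-comodule algebras, with structure morphism `ι : O ⟶ F` onto coinvariants,
is a quantum principal bundle over the quantum ringed space `(M, O)` with respect to the open
covering `U`. -/
structure IsQuantumPrincipalBundle (O : TopCat.Sheaf (AlgCat.{u} k) M)
    (F : ComoduleAlgebraSheaf k H M) (ι : O ⟶ F.sheaf) {I : Type*} (U : I → Opens M) : Prop where
  cover : iSup U = ⊤
  /-- `ι` takes values in the coinvariants -/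
  mem_coinvariants : ∀ (V : Opens M) (b : O.presheaf.obj (op V)),
    appHom ι V b ∈ coinvariants (F.coact V)
  /-- `ι` identifies `O(Uᵢ)` with the coinvariants of `F(Uᵢ)` -/
  injective : ∀ i, Function.Injective (appHom ι (U i))
  range_eq : ∀ i, (appHom ι (U i)).range = coinvariants (F.coact (U i))
  principal : ∀ i, IsPrincipal (F.coact (U i))

/-- The morphism `φ : F ⟶ F₀` makes the quantum principal `H₀`-bundle `F₀`, `H₀ = H ⧸ J`, an
algebraic reduction of the quantum principal `H`-bundle `F`, as witnessed by the open covering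
`U`. -/
structure IsAlgebraicReduction (J : Ideal H) [J.IsTwoSided] [J.IsHopfIdeal k]
    (O : TopCat.Sheaf (AlgCat.{u} k) M)
    (F : ComoduleAlgebraSheaf k H M) (ι : O ⟶ F.sheaf)
    (F₀ : ComoduleAlgebraSheaf k (H ⧸ J) M) (ι₀ : O ⟶ F₀.sheaf)
    (φ : F.sheaf ⟶ F₀.sheaf) {I : Type*} (U : I → Opens M) : Prop where
  bundle : IsQuantumPrincipalBundle O F ι U
  bundle₀ : IsQuantumPrincipalBundle O F₀ ι₀ U
  /-- `φ` is `H₀`-colinear for the induced `H₀`-coaction `(id ⊗ pr₀) ∘ ρ` on `F` -/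
  colinear : ∀ (V : Opens M) (a : F.sheaf.presheaf.obj (op V)),
    F₀.coact V (appHom φ V a) =
      Algebra.TensorProduct.map (appHom φ V) (Ideal.Quotient.mkₐ k J) (F.coact V a)
  map_coinvariants : ∀ i,
    (coinvariants (F.coact (U i))).map (appHom φ (U i)) = coinvariants (F₀.coact (U i))

/-- The ideal sheaf of `F` locally generated by subsets `S i` of `F(Uᵢ)`: a section `a` over `V`
belongs to it when every point of `V` has an open neighbourhood `W ⊆ V ∩ Uᵢ`, for some `i`, such
that `a|_W` lies in the two-sided ideal of `F(W)` generated by the restrictions to `W` of the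
elements of `S i`. -/
def locallyGeneratedIdeal (F : TopCat.Sheaf (AlgCat.{u} k) M) {I : Type*} (U : I → Opens M)
    (S : ∀ i, Set (F.presheaf.obj (op (U i)))) (V : Opens M) :
    Set (F.presheaf.obj (op V)) :=
  {a | ∀ x ∈ V, ∃ (i : I) (W : Opens M) (hV : W ≤ V) (hU : W ≤ U i), x ∈ W ∧
    res F hV a ∈ TwoSidedIdeal.span (res F hU '' S i)}

end Sheaves

end

end QuantumBundle

namespace QuantumBundle

noncomputable section

/-! Write `A` for the sections of `F` over one member of the covering, `B` for its coinvariants, `f`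
for the given map on `K`, `K⁺ = K ∩ ker ε`, and `π : A → A' = A / A f(K⁺)`. The local claim is that
`A'` is a principal comodule algebra over `H₀ = H / J` whose coinvariants are a copy of `B`.
Compatibility with the Miyashita-Ulbrich action gives `f(x) b = b₍₀₎ f(x ◁ b₍₁₎)`, so the left ideal
`A f(K⁺)` is two-sided (`mul_mem_span_augmentationImage`). Colinearity of `f` makes the coaction
descend: modulo the ideal `ρ(f(x))` becomes `1 ⊗ x`, and `x` maps to the scalar `ε(x)` in `H₀`.

The Galois property of `H` over `K` yields `J = H K⁺` (`le_span_coinvAugmentation`). Hence the map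
from `A ⊗ H` to `A' ⊗_B A'` given by the inverse of the canonical map of `A` kills the kernel of `A
⊗ H → A' ⊗ H₀`, and the canonical map of `A'` is bijective (`galois_of_quotient`).

Flatness comes from the bijection `A ⊗_K H ≅ A' ⊗ H`, `a ⊗ h ↦ π(a₍₀₎) ⊗ a₍₁₎h`, with inverse `π(a)
⊗ h ↦ a₍₀₎ ⊗ S(a₍₁₎)h`. It makes `(N ⊗_B A) ⊗_K H` a sum of copies of `N ⊗_B A'`, so exactness can
be tested on either (`exact_quotient_iff`), and faithful flatness of `A` over `B` and of `H` over
`K` passes to `A'` over `B`. A coinvariant `a` of `A'` satisfies `a ⊗ 1 = 1 ⊗ a` in `A' ⊗_B A'` by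
the Galois property, so it lies in the image of `B` by descent (`coinvariants_of_quotient`).

For the global statement, every point has a smallest open neighbourhood, and there are finitely many
of these. The sheaf associated with the quotient presheaf is modelled by compatible families over
the minimal neighbourhoods inside an open set (`minimalSheaf`). This is a finite limit, so it
commutes with `- ⊗ H₀` over a field and inherits the coaction (`minimalSections.exists_coaction`). A
nonempty member of the covering is itself minimal, so there the sheaf takes the value `A'` and the
local result applies. -/

/-! ### Exactness along families of maps -/

/-- If the additive groups `Yᵢ` are, naturally, locally finite retracts of sums of copies of the
groups `Xᵢ`, then exactness of the sequence of the `Xᵢ` implies exactness of that of the `Yᵢ`. -/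
theorem exact_of_locallyFinite_retract {ι X₁ X₂ X₃ Y₁ Y₂ Y₃ : Type*}
    [AddCommGroup X₁] [AddCommGroup X₂] [AddCommGroup X₃]
    [AddCommGroup Y₁] [AddCommGroup Y₂] [AddCommGroup Y₃]
    {f : X₁ →+ X₂} {g : X₂ →+ X₃} {f' : Y₁ →+ Y₂} {g' : Y₂ →+ Y₃}
    (c₁ : Y₁ →+ ι →₀ X₁) (c₂ : Y₂ →+ ι →₀ X₂) (c₃ : Y₃ →+ ι →₀ X₃)
    (d₁ : ι → X₁ →+ Y₁) (d₂ : ι → X₂ →+ Y₂) (d₃ : ι → X₃ →+ Y₃)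
    (hcf : ∀ y j, c₂ (f' y) j = f (c₁ y j)) (hcg : ∀ y j, c₃ (g' y) j = g (c₂ y j))
    (hdf : ∀ j x, d₂ j (f x) = f' (d₁ j x))
    (h₂ : ∀ y, (c₂ y).sum (fun j x => d₂ j x) = y)
    (h₃ : ∀ y, (c₃ y).sum (fun j x => d₃ j x) = y)
    (h : Function.Exact f g) : Function.Exact f' g' := by
  intro y
  constructor
  · intro hy
    -- Each component of `y` lifts separately; the lifts reassemble because only the finite support
    -- of `c₂ y` contributes.
    have hj : ∀ j, ∃ x, f x = c₂ y j := fun j => (h _).1 (by rw [← hcg, hy]; simp)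
    choose s hs using hj
    refine ⟨∑ j ∈ (c₂ y).support, d₁ j (s j), ?_⟩
    rw [map_sum]
    conv_rhs => rw [← h₂ y]
    exact Finset.sum_congr rfl fun j _ => by rw [← hdf, hs]
  · rintro ⟨y, rfl⟩
    rw [← h₃ (g' (f' y))]
    refine Finset.sum_eq_zero fun j _ => ?_
    simp only [hcg, hcf, (h _).2 ⟨_, rfl⟩, map_zero]

/-! ### Balanced tensor products -/

namespace BalancedTensor

section

variable {B : Type*} [Ring B] {N N' P G : Type*} [AddCommGroup N] [Module Bᵐᵒᵖ N]
  [AddCommGroup N'] [Module Bᵐᵒᵖ N'] [AddCommGroup P] [Module B P] [AddCommGroup G]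

theorem add_tmul (n n' : N) (p : P) : tmul B (n + n') p = tmul B n p + tmul B n' p := by
  simp [tmul, TensorProduct.add_tmul]

theorem tmul_add (n : N) (p p' : P) : tmul B n (p + p') = tmul B n p + tmul B n p' := by
  simp [tmul, TensorProduct.tmul_add]

/-- The biadditive map `(n, p) ↦ n ⊗ p`. -/
def tmulHom (B : Type*) [Ring B] (N P : Type*) [AddCommGroup N] [Module Bᵐᵒᵖ N]
    [AddCommGroup P] [Module B P] : N →+ P →+ BalancedTensor B N P :=
  AddMonoidHom.mk' (fun n => AddMonoidHom.mk' (tmul B n) (tmul_add n))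
    fun n n' => AddMonoidHom.ext fun p => add_tmul n n' p

@[simp]
theorem tmulHom_apply (n : N) (p : P) : tmulHom B N P n p = tmul B n p := rfl

@[simp]
theorem tmul_zero (n : N) : tmul B n (0 : P) = 0 := (tmulHom B N P n).map_zero

@[simp]
theorem zero_tmul (p : P) : tmul B (0 : N) p = 0 := by
  rw [← tmulHom_apply, map_zero, AddMonoidHom.zero_apply]

theorem smul_tmul (n : N) (b : B) (p : P) :
    tmul B (MulOpposite.op b • n) p = tmul B n (b • p) := by
  rw [tmul, tmul, QuotientAddGroup.eq_iff_sub_mem]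
  exact AddSubgroup.subset_closure ⟨n, b, p, rfl⟩

@[elab_as_elim]
theorem induction_on {motive : BalancedTensor B N P → Prop} (t : BalancedTensor B N P)
    (tmul : ∀ n p, motive (tmul B n p)) (add : ∀ s t, motive s → motive t → motive (s + t)) :
    motive t := by
  obtain ⟨t, rfl⟩ := QuotientAddGroup.mk_surjective t
  induction t using TensorProduct.induction_on with
  | zero =>
    have := tmul 0 0
    rwa [tmul_zero] at this
  | tmul n p => exact tmul n p
  | add s t hs ht => exact add _ _ hs ht

theorem hom_ext {f g : BalancedTensor B N P →+ G} (h : ∀ n p, f (tmul B n p) = g (tmul B n p)) :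
    f = g := by
  refine AddMonoidHom.ext fun t => ?_
  induction t using induction_on with
  | tmul n p => exact h n p
  | add s t hs ht => rw [map_add, map_add, hs, ht]

/-- The right action on `N ⊗_B P` induced by endomorphisms of the left module `P`. -/
def rightAction {C : Type*} [Ring C] (σ : Cᵐᵒᵖ →+* Module.End B P) :
    Cᵐᵒᵖ →+* AddMonoid.End (BalancedTensor B N P) where
  toFun c := lift ((tmulHom B N P).compl₂ (σ c).toAddMonoidHom)
    fun n b p => by simp [smul_tmul]
  map_one' := hom_ext fun n p => by
    change tmul B n (σ 1 p) = tmul B n p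
    simp
  map_mul' c d := hom_ext fun n p => by
    change tmul B n (σ (c * d) p) = tmul B n (σ c (σ d p))
    simp
  map_zero' := hom_ext fun n p => by
    change tmul B n (σ 0 p) = 0
    simp
  map_add' c d := hom_ext fun n p => by
    change tmul B n (σ (c + d) p) = tmul B n (σ c p) + tmul B n (σ d p)
    simp [tmul_add]

variable (N) in
/-- The right module structure on `N ⊗_B P` induced by endomorphisms of the left module `P`. -/
abbrev rightModuleOfEnd {C : Type*} [Ring C] (σ : Cᵐᵒᵖ →+* Module.End B P) :
    Module Cᵐᵒᵖ (BalancedTensor B N P) :=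
  Module.compHom (BalancedTensor B N P) (rightAction (N := N) σ)

theorem rightModuleOfEnd_smul_tmul {C : Type*} [Ring C] (σ : Cᵐᵒᵖ →+* Module.End B P) (c : Cᵐᵒᵖ)
    (n : N) (p : P) :
    letI := rightModuleOfEnd N σ
    c • tmul B n p = tmul B n (σ c p) := rfl

end

/-- The canonical map `N ⊗_k P → N ⊗_B P`. -/
def ofTensor (k : Type*) {B N P : Type*} [CommRing k] [Ring B] [Algebra k B] [AddCommGroup N]
    [Module k N] [Module Bᵐᵒᵖ N] [AddCommGroup P] [Module k P] [Module B P] [IsScalarTower k B P]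
    (hN : ∀ (c : k) (n : N), c • n = MulOpposite.op (algebraMap k B c) • n) :
    N ⊗[k] P →+ BalancedTensor B N P :=
  TensorProduct.liftAddHom (tmulHom B N P) fun c n p => by
    rw [hN, tmulHom_apply, smul_tmul, algebraMap_smul, tmulHom_apply]

theorem ofTensor_tmul (k : Type*) {B N P : Type*} [CommRing k] [Ring B] [Algebra k B]
    [AddCommGroup N] [Module k N] [Module Bᵐᵒᵖ N] [AddCommGroup P] [Module k P] [Module B P]
    [IsScalarTower k B P] (hN : ∀ (c : k) (n : N), c • n = MulOpposite.op (algebraMap k B c) • n)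
    (n : N) (p : P) : ofTensor (P := P) k hN (n ⊗ₜ p) = tmul B n p := rfl

end BalancedTensor

/-! ### Faithfully flat descent for a ring extension `R → T` -/

/-- A faithfully flat ring extension is injective. -/
theorem FaithfullyFlat.injective {R T : Type u} [Ring R] [Ring T] (j : R →+* T) [Module R T]
    [Module Rᵐᵒᵖ T] (hl : ∀ (r : R) (t : T), r • t = j r * t)
    (hr : ∀ (r : R) (t : T), MulOpposite.op r • t = t * j r) (hT : FaithfullyFlat R T) :
    Function.Injective j := by
  let μ : BalancedTensor R T T →+ T := BalancedTensor.lift AddMonoidHom.mul fun n b p => by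
    simp [hl, hr, mul_assoc]
  let jl : R →ₗ[Rᵐᵒᵖ] T :=
    { toFun := j
      map_add' := map_add j
      map_smul' := fun r x => by
        induction r using MulOpposite.rec' with
        | h r => simp [hr] }
  -- Injectivity is exactness of `0 → R → T`. After `- ⊗_R T` the second map is split by
  -- multiplication `T ⊗_R T → T ≅ R ⊗_R T`.
  let z : PUnit.{u + 1} →ₗ[Rᵐᵒᵖ] R := 0
  have hex : Function.Exact (BalancedTensor.map T z) (BalancedTensor.map T jl) := by
    let ν : T →+ BalancedTensor R R T := BalancedTensor.tmulHom R R T 1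
    have hν : ∀ t, ν (μ (BalancedTensor.map T jl t)) = t := by
      intro t
      induction t using BalancedTensor.induction_on with
      | tmul r t =>
        have h1 : μ (BalancedTensor.map T jl (BalancedTensor.tmul R r t)) = r • t :=
          (hl r t).symm
        rw [h1, BalancedTensor.tmulHom_apply, ← BalancedTensor.smul_tmul]
        simp
      | add s t hs ht => rw [map_add, map_add, map_add, hs, ht]
    intro t
    constructor
    · intro ht
      refine ⟨0, ?_⟩
      rw [← hν t, ht]
      simp
    · rintro ⟨t, rfl⟩
      have h0 : t = 0 := by
        induction t using BalancedTensor.induction_on with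
        | tmul r t => rw [Subsingleton.elim r 0, BalancedTensor.zero_tmul]
        | add s t hs ht => rw [hs, ht, add_zero]
      simp [h0]
  have h := (hT PUnit R T z jl).2 hex
  rw [injective_iff_map_eq_zero]
  intro r hr'
  obtain ⟨_, rfl⟩ := (h r).1 hr'
  rfl

/-- The action of `R` on a ring `T` over `R` by right multiplication, as endomorphisms of the left
module `T`. -/
def rightMulEnd {R S T : Type*} [Ring R] [Ring S] [Ring T] (j : R →+* T) [Module S T]
    (hl : ∀ (r : S) (t t' : T), r • (t * t') = r • t * t') : Rᵐᵒᵖ →+* Module.End S T where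
  toFun r :=
    { toFun := fun t => t * j r.unop
      map_add' := fun s t => add_mul s t _
      map_smul' := fun s t => (hl s t _).symm }
  map_one' := by ext; simp
  map_mul' r s := by ext; simp [mul_assoc]
  map_zero' := by ext; simp
  map_add' r s := by ext; simp [mul_add]

theorem rightMulEnd_apply {R S T : Type*} [Ring R] [Ring S] [Ring T] (j : R →+* T) [Module S T]
    (hl : ∀ (r : S) (t t' : T), r • (t * t') = r • t * t') (r : Rᵐᵒᵖ) (t : T) :
    rightMulEnd j hl r t = t * j r.unop := rfl

/-- The right multiplication of `T` on `T ⊗_R T`. -/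
def balancedMulRight {R T : Type u} [Ring R] [Ring T] [Module R T] [Module Rᵐᵒᵖ T]
    (hl : ∀ (r : R) (s t : T), r • (s * t) = r • s * t) :
    BalancedTensor R T T →+ T →+ BalancedTensor R T T :=
  BalancedTensor.lift
    (AddMonoidHom.mk' (fun a : T => AddMonoidHom.mk' (fun b : T =>
      (BalancedTensor.tmulHom R T T a).comp (AddMonoidHom.mulLeft b))
      fun b b' => AddMonoidHom.ext fun c => by simp [add_mul, BalancedTensor.tmul_add])
      fun a a' => AddMonoidHom.ext fun b => AddMonoidHom.ext fun c => by simp)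
    fun a r b => AddMonoidHom.ext fun c => by
      simp [← hl, BalancedTensor.smul_tmul]

theorem balancedMulRight_tmul {R T : Type u} [Ring R] [Ring T] [Module R T] [Module Rᵐᵒᵖ T]
    (hl : ∀ (r : R) (s t : T), r • (s * t) = r • s * t) (a b c : T) :
    balancedMulRight hl (BalancedTensor.tmul R a b) c = BalancedTensor.tmul R a (b * c) := rfl

theorem balancedMulRight_smul {R T : Type u} [Ring R] [Ring T] [Module R T] [Module Rᵐᵒᵖ T]
    (hl : ∀ (r : R) (s t : T), r • (s * t) = r • s * t)
    (hr : ∀ (r : R) (s t : T), (MulOpposite.op r • s) * t = s * r • t)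
    [Module Rᵐᵒᵖ (BalancedTensor R T T)]
    (hσ : ∀ (r : Rᵐᵒᵖ) (s t : T), r • BalancedTensor.tmul R s t = BalancedTensor.tmul R s (r • t))
    (s : BalancedTensor R T T) (r : R) (c : T) :
    balancedMulRight hl (MulOpposite.op r • s) c = balancedMulRight hl s (r • c) := by
  induction s using BalancedTensor.induction_on with
  | tmul a b => rw [hσ, balancedMulRight_tmul, balancedMulRight_tmul, hr]
  | add s t hs ht =>
    rw [smul_add, map_add, map_add, AddMonoidHom.add_apply, AddMonoidHom.add_apply, hs, ht]

/-- The sequence `R → T → T ⊗_R T` with second map `t ↦ t ⊗ 1 - 1 ⊗ t` becomes exact after `- ⊗_R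
T`: the contraction `a ⊗ b ⊗ c ↦ a ⊗ bc` sends the image of `a ⊗ b` to `a ⊗ b - 1 ⊗ ab`. The right
action on the second factor of `T ⊗_R T` is what makes the second map right linear. -/
theorem FaithfullyFlat.mem_range_aux {R T : Type u} [Ring R] [Ring T] (j : R →+* T) [Module R T]
    [Module Rᵐᵒᵖ T] (hl : ∀ (r : R) (t : T), r • t = j r * t)
    (hr : ∀ (r : R) (t : T), MulOpposite.op r • t = t * j r) (hT : FaithfullyFlat R T)
    [Module Rᵐᵒᵖ (BalancedTensor R T T)]
    (hσ : ∀ (r : Rᵐᵒᵖ) (s t : T), r • BalancedTensor.tmul R s t = BalancedTensor.tmul R s (r • t))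
    {t : T} (ht : BalancedTensor.tmul R t 1 = BalancedTensor.tmul R 1 t) : t ∈ Set.range j := by
  let μ : BalancedTensor R T T →+ T := BalancedTensor.lift AddMonoidHom.mul fun n b p => by
    simp [hl, hr, mul_assoc]
  let jl : R →ₗ[Rᵐᵒᵖ] T :=
    { toFun := j
      map_add' := map_add j
      map_smul' := fun r x => by
        induction r using MulOpposite.rec' with
        | h r => simp [hr] }
  let e : T →ₗ[Rᵐᵒᵖ] BalancedTensor R T T :=
    { toFun := fun t => BalancedTensor.tmul R t 1 - BalancedTensor.tmul R 1 t
      map_add' := fun s t => by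
        rw [BalancedTensor.add_tmul, BalancedTensor.tmul_add]
        abel
      map_smul' := fun r t => by
        rw [RingHom.id_apply, smul_sub, hσ, hσ]
        induction r using MulOpposite.rec' with
        | h r => rw [BalancedTensor.smul_tmul, hl, hr, hr, one_mul, mul_one] }
  have he : ∀ t, e t = BalancedTensor.tmul R t 1 - BalancedTensor.tmul R 1 t := fun _ => rfl
  have hex : Function.Exact (BalancedTensor.map T jl) (BalancedTensor.map T e) := by
    intro t
    constructor
    · let w : BalancedTensor R (BalancedTensor R T T) T →+ BalancedTensor R T T :=
        BalancedTensor.lift (balancedMulRight fun r s t => by simp [hl, mul_assoc])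
          (balancedMulRight_smul _ (fun r s t => by simp [hl, hr, mul_assoc]) hσ)
      have hw₀ : ∀ a b c : T, w (BalancedTensor.tmul R (BalancedTensor.tmul R a b) c) =
          BalancedTensor.tmul R a (b * c) := fun _ _ _ => rfl
      have hw : ∀ s, w (BalancedTensor.map T e s) = s - BalancedTensor.tmul R 1 (μ s) := by
        intro s
        induction s using BalancedTensor.induction_on with
        | tmul a b =>
          rw [BalancedTensor.map_tmul, he, ← BalancedTensor.tmulHom_apply, map_sub,
            AddMonoidHom.sub_apply, map_sub, BalancedTensor.tmulHom_apply,
            BalancedTensor.tmulHom_apply, hw₀, hw₀, one_mul]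
          rfl
        | add s t hs ht =>
          rw [map_add, map_add, map_add, hs, ht, BalancedTensor.tmul_add]
          abel
      intro ht
      refine ⟨BalancedTensor.tmul R 1 (μ t), ?_⟩
      have := hw t
      rw [ht, map_zero, eq_comm, sub_eq_zero] at this
      rw [BalancedTensor.map_tmul]
      conv_rhs => rw [this]
      simp [jl]
    · rintro ⟨s, rfl⟩
      induction s using BalancedTensor.induction_on with
      | tmul r t =>
        rw [BalancedTensor.map_tmul, BalancedTensor.map_tmul]
        -- By right linearity, `e` vanishes on the image of `R` because `e 1 = 0`.
        have h1 : jl r = MulOpposite.op r • (1 : T) := by simp [jl, hr]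
        rw [h1, map_smul, he, sub_self, smul_zero, BalancedTensor.zero_tmul]
      | add s t hs ht => rw [map_add, map_add, hs, ht, add_zero]
  have h := (hT R T (BalancedTensor R T T) jl e).2 hex
  exact (h t).1 (sub_eq_zero.2 ht)

/-- Faithfully flat descent: the image of a faithfully flat ring extension `R → T` is the equalizer
of the two maps `T → T ⊗_R T`. -/
theorem FaithfullyFlat.mem_range {R T : Type u} [Ring R] [Ring T] (j : R →+* T) [Module R T]
    [Module Rᵐᵒᵖ T] (hl : ∀ (r : R) (t : T), r • t = j r * t)
    (hr : ∀ (r : R) (t : T), MulOpposite.op r • t = t * j r) (hT : FaithfullyFlat R T)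
    {t : T} (ht : BalancedTensor.tmul R t 1 = BalancedTensor.tmul R 1 t) : t ∈ Set.range j := by
  have hl' : ∀ (r : R) (s t : T), r • (s * t) = r • s * t := fun r s t => by simp [hl, mul_assoc]
  let _ : Module Rᵐᵒᵖ (BalancedTensor R T T) :=
    BalancedTensor.rightModuleOfEnd T (rightMulEnd j hl')
  refine FaithfullyFlat.mem_range_aux j hl hr hT (fun r a b => ?_) ht
  have h1 := BalancedTensor.rightModuleOfEnd_smul_tmul (N := T) (rightMulEnd j hl') r a b
  rw [rightMulEnd_apply, ← hr, MulOpposite.op_unop] at h1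
  exact h1

/-! ### The coinvariants `K` and the Hopf ideal `J` -/

section Hopf

variable {k H A A' : Type u} [Field k] [Ring H] [HopfAlgebra k H] [Ring A] [Algebra k A]
  [Ring A'] [Algebra k A'] {J : Ideal H} [J.IsTwoSided] [J.IsHopfIdeal k]

/-- Elements of `K` become scalars in `H ⧸ J`. -/
theorem mk_eq_counit_of_mem_coinvH {x : H} (hx : x ∈ coinvH k J) :
    Ideal.Quotient.mkₐ k J x = algebraMap k (H ⧸ J) (Coalgebra.counit x) := by
  -- Applying `id ⊗ ε` to `pr₀(x₍₁₎) ⊗ x₍₂₎ = 1 ⊗ x` gives the claim.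
  let w : (H ⧸ J) ⊗[k] H →ₗ[k] H ⧸ J :=
    (TensorProduct.rid k (H ⧸ J)).toLinearMap ∘ₗ LinearMap.lTensor (H ⧸ J) Coalgebra.counit
  have hw : ∀ t : H ⊗[k] H, w (TensorProduct.map (Ideal.Quotient.mkₐ k J).toLinearMap
      LinearMap.id t) = Ideal.Quotient.mkₐ k J (TensorProduct.rid k H
        (LinearMap.lTensor H Coalgebra.counit t)) := by
    intro t
    induction t with
    | zero => simp
    | tmul a b => simp [w]
    | add s t hs ht => simp only [map_add, hs, ht]
  have h1 : quotientCoaction k J x = (1 : H ⧸ J) ⊗ₜ[k] x := hx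
  have h2 : w (quotientCoaction k J x) = Ideal.Quotient.mkₐ k J x := by
    have := hw (Coalgebra.comul x)
    rw [Coalgebra.lTensor_counit_comul, TensorProduct.rid_tmul, one_smul] at this
    exact this
  rw [← h2, h1]
  simp [w, Algebra.algebraMap_eq_smul_one]

/-- The counit is multiplicative and `ε ∘ S = ε`. The consequence needed later is that the adjoint
action preserves `K ∩ ker ε`. -/
theorem counit_adjointMap (x h : H) : Coalgebra.counit (R := k) (adjointMap k x h) =
    Coalgebra.counit (R := k) x * Coalgebra.counit (R := k) h := by
  have key : ∀ t : H ⊗[k] H, Coalgebra.counit (R := k) (LinearMap.mul' k H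
      (TensorProduct.map (HopfAlgebra.antipode k) (LinearMap.mulLeft k x) t)) =
      Coalgebra.counit (R := k) x * Coalgebra.counit (R := k)
        (TensorProduct.lid k H (LinearMap.rTensor H Coalgebra.counit t)) := by
    intro t
    induction t with
    | zero => simp
    | tmul a b => simp; ring
    | add s t hs ht => simp only [map_add, hs, ht, mul_add]
  rw [adjointMap, LinearMap.comp_apply, LinearMap.comp_apply, key,
    Coalgebra.rTensor_counit_comul, TensorProduct.lid_tmul, one_smul]

/-- If `π` is trivial on the image of `K`, then `(π ⊗ id) ρ(g(x)) = 1 ⊗ x` for `x` in `K`. -/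
theorem map_coaction_of_trivial {ρ : A →ₐ[k] A ⊗[k] H} {g : coinvH k J →ₐ[k] A}
    (hg : ∀ x, ρ (g x) = TensorProduct.map g.toLinearMap LinearMap.id (coinvCoaction k J x))
    {π : A →ₐ[k] A'} (hπ : ∀ x : coinvH k J, Coalgebra.counit (R := k) (x : H) = 0 → π (g x) = 0)
    (x : coinvH k J) :
    Algebra.TensorProduct.map π (AlgHom.id k H) (ρ (g x)) = (1 : A') ⊗ₜ[k] (x : H) := by
  -- Since `x - ε(x)` lies in the augmentation ideal, `π ∘ g` is the counit on `K`, and `π(g(x₍₁₎))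
  -- ⊗ x₍₂₎` collapses to `1 ⊗ x`.
  have h1 : ∀ x : coinvH k J, π (g x) = algebraMap k A' (Coalgebra.counit (x : H)) := by
    intro x
    have := hπ (x - algebraMap k _ (Coalgebra.counit (x : H))) (by simp)
    rwa [map_sub, map_sub, AlgHom.commutes, AlgHom.commutes, sub_eq_zero] at this
  have h2 : ∀ t : coinvH k J ⊗[k] H, Algebra.TensorProduct.map π (AlgHom.id k H)
      (TensorProduct.map g.toLinearMap LinearMap.id t) =
      (1 : A') ⊗ₜ[k] TensorProduct.lid k H
        (LinearMap.rTensor H Coalgebra.counit (inclTensor k J t)) := by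
    intro t
    induction t with
    | zero => simp
    | tmul a b =>
      simp [h1, inclTensor, Algebra.algebraMap_eq_smul_one, TensorProduct.smul_tmul]
    | add s t hs ht => simp only [map_add, hs, ht, TensorProduct.tmul_add]
  rw [hg, h2, inclTensor_coinvCoaction, Coalgebra.rTensor_counit_comul, TensorProduct.lid_tmul,
    one_smul]

variable (k J) in
/-- The augmentation ideal of `K`, as a subset of `H`. -/
def coinvAugmentation : Set H := {x | x ∈ coinvH k J ∧ Coalgebra.counit (R := k) x = 0}

/-- If `H` is a Galois extension of `K`, then `J = H (K ∩ ker ε)`. -/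
theorem le_span_coinvAugmentation
    (hJ : Function.Injective (leftCanonicalMap (quotientCoaction k J))) :
    J ≤ Ideal.span (coinvAugmentation k J) := by
  let q : H →ₗ[H] H ⧸ Ideal.span (coinvAugmentation k J) := Submodule.mkQ _
  have hq : ∀ (a : H) (x : coinvH k J),
      q (a * x) = q (Coalgebra.counit (R := k) (x : H) • a) := by
    intro a x
    rw [← sub_eq_zero, ← map_sub]
    have : a * (x : H) - Coalgebra.counit (R := k) (x : H) • a =
        a * ((x - algebraMap k _ (Coalgebra.counit (x : H)) : coinvH k J) : H) := by
      simp [mul_sub, Algebra.algebraMap_eq_smul_one]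
    rw [this]
    refine (Submodule.Quotient.mk_eq_zero _).2 (Ideal.mul_mem_left _ _ (Ideal.subset_span ⟨?_, ?_⟩))
    · exact SetLike.coe_mem _
    · simp
  -- The map `a ⊗ b ↦ ε(b) a` is balanced over `K` once `H (K ∩ ker ε)` is divided out, because
  -- there `ax` equals `ε(x) a`.
  let ψ : BalancedTensor (coinvH k J) H H →+ H ⧸ Ideal.span (coinvAugmentation k J) :=
    BalancedTensor.lift
      (AddMonoidHom.mk' (fun a => AddMonoidHom.mk'
        (fun b => q (Coalgebra.counit (R := k) b • a)) fun b b' => by simp [add_smul])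
        fun a a' => AddMonoidHom.ext fun b => by simp)
      fun a x b => by
        have := hq (Coalgebra.counit (R := k) b • a) x
        simpa [op_smul_eq, Subalgebra.smul_def, smul_smul] using this
  let β : H ⊗[k] H →+ BalancedTensor (coinvH k J) H H :=
    BalancedTensor.ofTensor k fun c a => by
      rw [op_smul_eq, Algebra.smul_def]
      exact Algebra.commutes c a
  let S : H →ₗ[k] H := HopfAlgebra.antipode k
  let pr : H →ₗ[k] H ⧸ J := (Ideal.Quotient.mkₐ k J).toLinearMap
  have h1 : ∀ t : H ⊗[k] H, ψ (β (S.lTensor H t)) =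
      q (TensorProduct.rid k H (Coalgebra.counit.lTensor H t)) := by
    intro t
    induction t with
    | zero => simp
    | tmul a b =>
      rw [LinearMap.lTensor_tmul, LinearMap.lTensor_tmul, TensorProduct.rid_tmul,
        BalancedTensor.ofTensor_tmul]
      change q (Coalgebra.counit (R := k) (S b) • a) = _
      rw [HopfAlgebra.counit_antipode]
    | add s t hs ht => simp only [map_add, hs, ht]
  have h2 : ∀ t : H ⊗[k] H, leftCanonicalMap (quotientCoaction k J) (β (S.lTensor H t)) =
      TensorProduct.map pr (LinearMap.mul' k H ∘ₗ S.lTensor H) (TensorProduct.assoc k H H H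
        (Coalgebra.comul.rTensor H t)) := by
    intro t
    induction t with
    | zero => simp
    | tmul a b =>
      rw [LinearMap.lTensor_tmul, BalancedTensor.ofTensor_tmul, leftCanonicalMap_tmul,
        LinearMap.rTensor_tmul]
      change TensorProduct.map pr LinearMap.id (Coalgebra.comul (R := k) a) * _ = _
      generalize Coalgebra.comul (R := k) a = u
      induction u with
      | zero => simp
      | tmul c d => simp
      | add s t hs ht => simp only [map_add, TensorProduct.add_tmul, add_mul, hs, ht]
    | add s t hs ht => simp only [map_add, hs, ht]
  intro x hx
  -- The canonical map sends `x₍₁₎ ⊗ S(x₍₂₎)` to `pr₀(x₍₁₎) ⊗ x₍₂₎ S(x₍₃₎) = pr₀(x) ⊗ 1`, which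
  -- vanishes for `x` in `J`. By injectivity the tensor itself vanishes, while `ψ` sends it to the
  -- class of `x`.
  have h3 : leftCanonicalMap (quotientCoaction k J) (β (S.lTensor H (Coalgebra.comul x))) = 0 := by
    rw [h2, Coalgebra.coassoc_apply, ← LinearMap.comp_apply (TensorProduct.map _ _),
      LinearMap.map_comp_lTensor, LinearMap.comp_assoc,
      HopfAlgebra.mul_antipode_lTensor_comul]
    have h4 : ∀ t : H ⊗[k] H, TensorProduct.map pr (Algebra.linearMap k H ∘ₗ Coalgebra.counit) t =
        pr (TensorProduct.rid k H (Coalgebra.counit.lTensor H t)) ⊗ₜ (1 : H) := by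
      intro t
      induction t with
      | zero => simp
      | tmul a b => simp [Algebra.algebraMap_eq_smul_one, TensorProduct.smul_tmul]
      | add s t hs ht => simp only [map_add, hs, ht, TensorProduct.add_tmul]
    rw [h4, Coalgebra.lTensor_counit_comul, TensorProduct.rid_tmul, one_smul]
    have : pr x = 0 := Ideal.Quotient.eq_zero_iff_mem.2 hx
    rw [this, TensorProduct.zero_tmul]
  have h5 : β (S.lTensor H (Coalgebra.comul x)) = 0 := hJ (by rw [h3, map_zero])
  have h6 := h1 (Coalgebra.comul x)
  rw [h5, map_zero, Coalgebra.lTensor_counit_comul, TensorProduct.rid_tmul, one_smul] at h6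
  exact (Submodule.Quotient.mk_eq_zero _).1 h6.symm

/-- A coaction descends along a surjection compatible with a Hopf algebra quotient. -/
theorem IsRightCoaction.of_surjective {ρ : A →ₐ[k] A ⊗[k] H} (hρ : IsRightCoaction ρ)
    {π : A →ₐ[k] A'} (hπ : Function.Surjective π) {ρ' : A' →ₐ[k] A' ⊗[k] (H ⧸ J)}
    (h : ∀ a, ρ' (π a) = Algebra.TensorProduct.map π (Ideal.Quotient.mkₐ k J) (ρ a)) :
    IsRightCoaction ρ' := by
  let pr : H →ₗ[k] H ⧸ J := (Ideal.Quotient.mkₐ k J).toLinearMap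
  have hpr : ∀ x, Coalgebra.comul (R := k) (pr x) =
      TensorProduct.map pr pr (Coalgebra.comul (R := k) x) := fun x => rfl
  have hε : ∀ x, Coalgebra.counit (R := k) (pr x) = Coalgebra.counit (R := k) x := fun x => rfl
  constructor
  · intro a
    obtain ⟨a, rfl⟩ := hπ a
    rw [h]
    have h1 : ∀ t : A ⊗[k] H, TensorProduct.assoc k A' (H ⧸ J) (H ⧸ J)
        (TensorProduct.map ρ'.toLinearMap LinearMap.id
          (Algebra.TensorProduct.map π (Ideal.Quotient.mkₐ k J) t)) =
        TensorProduct.map π.toLinearMap (TensorProduct.map pr pr)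
          (TensorProduct.assoc k A H H (TensorProduct.map ρ.toLinearMap LinearMap.id t)) := by
      intro t
      induction t with
      | zero => simp
      | tmul a b =>
        simp only [Algebra.TensorProduct.map_tmul, TensorProduct.map_tmul, LinearMap.id_apply,
          AlgHom.toLinearMap_apply, h]
        generalize ρ a = u
        induction u with
        | zero => simp
        | tmul c d => simp [pr]
        | add s t hs ht => simp only [map_add, TensorProduct.add_tmul, hs, ht]
      | add s t hs ht => simp only [map_add, hs, ht]
    have h2 : ∀ t : A ⊗[k] H, TensorProduct.map LinearMap.id (Coalgebra.comul (R := k))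
        (Algebra.TensorProduct.map π (Ideal.Quotient.mkₐ k J) t) =
        TensorProduct.map π.toLinearMap (TensorProduct.map pr pr)
          (TensorProduct.map LinearMap.id (Coalgebra.comul (R := k)) t) := by
      intro t
      induction t with
      | zero => simp
      | tmul a b => simp [← hpr]; rfl
      | add s t hs ht => simp only [map_add, hs, ht]
    rw [h1, h2, hρ.coassoc]
  · intro a
    obtain ⟨a, rfl⟩ := hπ a
    rw [h]
    have h1 : ∀ t : A ⊗[k] H, TensorProduct.map LinearMap.id (Coalgebra.counit (R := k))
        (Algebra.TensorProduct.map π (Ideal.Quotient.mkₐ k J) t) =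
        TensorProduct.map π.toLinearMap LinearMap.id
          (TensorProduct.map LinearMap.id (Coalgebra.counit (R := k)) t) := by
      intro t
      induction t with
      | zero => simp
      | tmul a b => simp [← hε]
      | add s t hs ht => simp only [map_add, hs, ht]
    rw [h1, hρ.counit]
    simp

end Hopf

/-! ### The ideal `A f(K ∩ ker ε)` and the Galois property of the quotient -/

section Galois

variable {k H A : Type u} [Field k] [Ring H] [HopfAlgebra k H] [Ring A] [Algebra k A]

/-- Left multiplication on `A ⊗_B A`. -/
def balancedMulLeft (ρ : A →ₐ[k] A ⊗[k] H) (a : A) :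
    BalancedTensor (coinvariants ρ) A A →+ BalancedTensor (coinvariants ρ) A A :=
  BalancedTensor.map A
    { toFun := fun x => a * x
      map_add' := mul_add a
      map_smul' := fun _ x => (mul_assoc a x _).symm }

theorem balancedMulLeft_tmul (ρ : A →ₐ[k] A ⊗[k] H) (a x y : A) :
    balancedMulLeft ρ a (BalancedTensor.tmul _ x y) = BalancedTensor.tmul _ (a * x) y := rfl

theorem canonicalMap_balancedMulLeft (ρ : A →ₐ[k] A ⊗[k] H) (a : A)
    (s : BalancedTensor (coinvariants ρ) A A) :
    canonicalMap ρ (balancedMulLeft ρ a s) = (a ⊗ₜ[k] (1 : H)) * canonicalMap ρ s := by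
  induction s using BalancedTensor.induction_on with
  | tmul x y =>
    rw [balancedMulLeft_tmul, canonicalMap_tmul, canonicalMap_tmul, ← mul_assoc,
      Algebra.TensorProduct.tmul_mul_tmul, one_mul]
  | add s t hs ht => rw [map_add, map_add, map_add, hs, ht, mul_add]

theorem sandwich_balancedMulLeft (ρ : A →ₐ[k] A ⊗[k] H) (x : coinvariantCentralizer ρ) (a : A)
    (s : BalancedTensor (coinvariants ρ) A A) :
    sandwich ρ x (balancedMulLeft ρ a s) = a * sandwich ρ x s := by
  induction s using BalancedTensor.induction_on with
  | tmul y z => rw [balancedMulLeft_tmul, sandwich_tmul, sandwich_tmul, mul_assoc, mul_assoc,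
      mul_assoc]
  | add s t hs ht => rw [map_add, map_add, map_add, hs, ht, mul_add]

theorem canonicalMap_translationMap (ρ : A →ₐ[k] A ⊗[k] H)
    (hρ : Function.Bijective (canonicalMap ρ)) (h : H) :
    canonicalMap ρ (translationMap ρ hρ h) = (1 : A) ⊗ₜ[k] h :=
  (Equiv.ofBijective _ hρ).apply_symm_apply _

variable {J : Ideal H} [J.IsTwoSided] [J.IsHopfIdeal k]

/-- The left ideal `A f(K ∩ ker ε)` is two-sided. -/
theorem mul_mem_span_augmentationImage {ρ : A →ₐ[k] A ⊗[k] H}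
    {hρ : Function.Bijective (canonicalMap ρ)} {f : coinvH k J →ₐ[k] coinvariantCentralizer ρ}
    (hf : IsModuleComoduleMap J ρ hρ f) {a : A} (ha : a ∈ Ideal.span (augmentationImage f))
    (b : A) : a * b ∈ Ideal.span (augmentationImage f) := by
  -- For `u = c ⊗ h` the preimage under the canonical map is `c τ(h)`, and sandwiching `f(x)` in it
  -- gives `c f(x ◁ h)`, which is in the left ideal.
  have key : ∀ x : coinvH k J, Coalgebra.counit (R := k) (x : H) = 0 → ∀ u : A ⊗[k] H,
      ∃ s, canonicalMap ρ s = u ∧ sandwich ρ (f x) s ∈ Ideal.span (augmentationImage f) := by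
    intro x hx u
    induction u with
    | zero => exact ⟨0, by simp, by simp⟩
    | tmul c h =>
      refine ⟨balancedMulLeft ρ c (translationMap ρ hρ h), ?_, ?_⟩
      · rw [canonicalMap_balancedMulLeft, canonicalMap_translationMap]
        simp
      · rw [sandwich_balancedMulLeft]
        refine Ideal.mul_mem_left _ _ (Ideal.subset_span ⟨adjointAction k x h, ?_, ?_⟩)
        · change Coalgebra.counit (R := k) (adjointMap k (x : H) h) = 0
          rw [counit_adjointMap, hx, zero_mul]
        · exact hf.map_action x h
    | add u v hu hv =>
      obtain ⟨s, hs, hs'⟩ := hu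
      obtain ⟨t, ht, ht'⟩ := hv
      exact ⟨s + t, by rw [map_add, hs, ht], by rw [map_add]; exact add_mem hs' ht'⟩
  induction ha using Submodule.span_induction with
  | mem a ha =>
    obtain ⟨x, hx, rfl⟩ := ha
    obtain ⟨s, hs, hs'⟩ := key x hx (ρ b)
    -- The preimage of `ρ(b)` is `1 ⊗ b`, and sandwiching `f(x)` in it gives `f(x) b`.
    have : s = BalancedTensor.tmul _ 1 b := hρ.1 (by
      rw [hs, canonicalMap_tmul, ← Algebra.TensorProduct.one_def, one_mul])
    rwa [this, sandwich_tmul, one_mul] at hs'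
  | zero => simp
  | add a c _ _ ha hc =>
    rw [add_mul]
    exact add_mem ha hc
  | smul c a _ ha =>
    rw [smul_eq_mul, mul_assoc]
    exact Ideal.mul_mem_left _ _ ha

/-- This reconciles the two-sided ideals that define the quotient presheaf with the left ideals on
which the flatness and Galois arguments rely. -/
theorem span_augmentationImage_eq {ρ : A →ₐ[k] A ⊗[k] H}
    {hρ : Function.Bijective (canonicalMap ρ)} {f : coinvH k J →ₐ[k] coinvariantCentralizer ρ}
    (hf : IsModuleComoduleMap J ρ hρ f) (a : A) :
    a ∈ TwoSidedIdeal.span (augmentationImage f) ↔ a ∈ Ideal.span (augmentationImage f) := by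
  constructor
  · intro ha
    have : (Ideal.span (augmentationImage f)).IsTwoSided :=
      ⟨fun b ha => mul_mem_span_augmentationImage hf ha b⟩
    have h : TwoSidedIdeal.span (augmentationImage f) ≤
        (Ideal.span (augmentationImage f)).toTwoSided :=
      TwoSidedIdeal.span_le.2 fun a ha => by
        simpa using Ideal.subset_span ha
    simpa using h ha
  · intro ha
    have : Ideal.span (augmentationImage f) ≤
        TwoSidedIdeal.asIdeal (TwoSidedIdeal.span (augmentationImage f)) :=
      Ideal.span_le.2 TwoSidedIdeal.subset_span
    exact TwoSidedIdeal.mem_asIdeal.1 (this ha)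

variable {A' : Type u} [Ring A'] [Algebra k A']

/-- The Galois property descends to quotients trivializing the action of `K`. -/
theorem galois_of_quotient {ρ : A →ₐ[k] A ⊗[k] H}
    (hJ : Function.Injective (leftCanonicalMap (quotientCoaction k J)))
    (hρ : Function.Bijective (canonicalMap ρ)) {g : coinvH k J →ₐ[k] A}
    (hg : ∀ x, ρ (g x) = TensorProduct.map g.toLinearMap LinearMap.id (coinvCoaction k J x))
    {π : A →ₐ[k] A'} (hπ : Function.Surjective π)
    (hπg : ∀ x : coinvH k J, Coalgebra.counit (R := k) (x : H) = 0 → π (g x) = 0)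
    {ρ' : A' →ₐ[k] A' ⊗[k] (H ⧸ J)}
    (hρ' : ∀ a, ρ' (π a) = Algebra.TensorProduct.map π (Ideal.Quotient.mkₐ k J) (ρ a))
    {C : Type*} [Ring C] [Module C A'] [Module Cᵐᵒᵖ A'] (p : coinvariants ρ → C)
    (hl : ∀ b a, p b • π a = π (b * a)) (hr : ∀ b a, MulOpposite.op (p b) • π a = π (a * b))
    (χ : BalancedTensor C A' A' →+ A' ⊗[k] (H ⧸ J))
    (hχ : ∀ a b, χ (BalancedTensor.tmul C a b) = (a ⊗ₜ[k] 1) * ρ' b) :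
    Function.Bijective χ := by
  let pr : H →ₐ[k] H ⧸ J := Ideal.Quotient.mkₐ k J
  let q : BalancedTensor (coinvariants ρ) A A →+ BalancedTensor C A' A' :=
    BalancedTensor.lift
      (((BalancedTensor.tmulHom C A' A').compl₂ (π : A →+ A')).comp (π : A →+ A'))
      fun a b c => by
        have h1 := BalancedTensor.smul_tmul (π a) (p b) (π c)
        rw [hl, hr] at h1
        exact h1
  have hq : ∀ a b, q (BalancedTensor.tmul _ a b) = BalancedTensor.tmul C (π a) (π b) :=
    fun _ _ => rfl
  have hqsurj : Function.Surjective q := by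
    intro t
    induction t using BalancedTensor.induction_on with
    | tmul a b =>
      obtain ⟨a, rfl⟩ := hπ a
      obtain ⟨b, rfl⟩ := hπ b
      exact ⟨_, hq a b⟩
    | add s t hs ht =>
      obtain ⟨s, rfl⟩ := hs
      obtain ⟨t, rfl⟩ := ht
      exact ⟨s + t, map_add _ _ _⟩
  have hχq : ∀ s, χ (q s) = Algebra.TensorProduct.map π pr (canonicalMap ρ s) := by
    intro s
    induction s using BalancedTensor.induction_on with
    | tmul a b => simp [hq, hχ, hρ', canonicalMap_tmul, pr]
    | add s t hs ht => simp only [map_add, hs, ht]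
  constructor
  · let E : BalancedTensor (coinvariants ρ) A A ≃+ A ⊗[k] H := AddEquiv.ofBijective _ hρ
    -- Injectivity of `χ` amounts to `θ` killing `ker (π ⊗ pr) = ker π ⊗ H + A ⊗ J`. The first
    -- summand is handled by left linearity of the canonical map, the second by `J = H (K ∩ ker ε)`.
    let θ : A ⊗[k] H →+ BalancedTensor C A' A' := q.comp E.symm.toAddMonoidHom
    have hθ : ∀ s, θ (canonicalMap ρ s) = q s := fun s =>
      congrArg q (E.symm_apply_apply s)
    have hθ₁ : ∀ (a : A) (h : H), π a = 0 → θ (a ⊗ₜ h) = 0 := by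
      intro a h ha
      have h1 : a ⊗ₜ[k] h = canonicalMap ρ (balancedMulLeft ρ a (translationMap ρ hρ h)) := by
        rw [canonicalMap_balancedMulLeft, canonicalMap_translationMap]
        simp
      rw [h1, hθ]
      generalize translationMap ρ hρ h = s
      induction s using BalancedTensor.induction_on with
      | tmul x y => rw [balancedMulLeft_tmul, hq, map_mul, ha, zero_mul, BalancedTensor.zero_tmul]
      | add s t hs ht => rw [map_add, map_add, hs, ht, add_zero]
    have hker : Function.Exact (LinearMap.ker π.toLinearMap).subtype π.toLinearMap :=
      LinearMap.exact_subtype_ker_map _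
    have hθ' : ∀ t, θ (LinearMap.rTensor H (LinearMap.ker π.toLinearMap).subtype t) = 0 := by
      intro t
      induction t with
      | zero => simp
      | tmul a h => exact hθ₁ a h a.2
      | add s t hs ht => rw [map_add, map_add, hs, ht, add_zero]
    have hθ₂ : ∀ t : A ⊗[k] H, Algebra.TensorProduct.map π (AlgHom.id k H) t = 0 → θ t = 0 := by
      intro t ht
      obtain ⟨t, rfl⟩ := (rTensor_exact H hker hπ t).1 ht
      exact hθ' t
    have hθ₃ : ∀ j ∈ J, ∀ a : A, θ (a ⊗ₜ j) = 0 := by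
      intro j hj
      -- The extra left factor `h` lets the induction over the left ideal `H (K ∩ ker ε)` pass
      -- through left multiples.
      suffices ∀ (h : H) (a : A), θ (a ⊗ₜ (h * j)) = 0 from fun a => by
        simpa using this 1 a
      have hj' := le_span_coinvAugmentation hJ hj
      clear hj
      induction hj' using Submodule.span_induction with
      | mem x hx =>
        intro h a
        let x' : coinvH k J := ⟨x, hx.1⟩
        obtain ⟨s, hs⟩ := hρ.2 (a ⊗ₜ h)
        let R : BalancedTensor (coinvariants ρ) A A →+ BalancedTensor (coinvariants ρ) A A :=
          BalancedTensor.rightAction (rightMulEnd (g : coinvH k J →+* A)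
            fun r t t' => (smul_mul_assoc r t t').symm) (MulOpposite.op x')
        have hR : ∀ a b, R (BalancedTensor.tmul _ a b) = BalancedTensor.tmul _ a (b * g x') :=
          fun _ _ => rfl
        have hR₁ : ∀ s, canonicalMap ρ (R s) = canonicalMap ρ s * ρ (g x') := by
          intro s
          induction s using BalancedTensor.induction_on with
          | tmul a b => rw [hR, canonicalMap_tmul, canonicalMap_tmul, map_mul, mul_assoc]
          | add s t hs ht => rw [map_add, map_add, map_add, hs, ht, add_mul]
        have hR₂ : ∀ s, q (R s) = 0 := by
          intro s
          induction s using BalancedTensor.induction_on with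
          | tmul a b => rw [hR, hq, map_mul, hπg x' hx.2, mul_zero, BalancedTensor.tmul_zero]
          | add s t hs ht => rw [map_add, map_add, hs, ht, add_zero]
        -- Modulo `ker π ⊗ H`, multiplication by `ρ(g(x))` is multiplication by `1 ⊗ x`. On `A ⊗_B
        -- A` it is right multiplication of the second factor by `g(x)`, which `q` kills.
        have h1 : θ ((a ⊗ₜ[k] h) * ρ (g x') - a ⊗ₜ[k] (h * x)) = 0 := by
          apply hθ₂
          rw [map_sub, map_mul, map_coaction_of_trivial hg hπg]
          simp [x']
        rw [map_sub, ← hs, ← hR₁, hθ, hR₂, zero_sub, neg_eq_zero] at h1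
        exact h1
      | zero => simp
      | add x y _ _ hx hy =>
        intro h a
        rw [mul_add, TensorProduct.tmul_add, map_add, hx, hy, add_zero]
      | smul c x _ hx =>
        intro h a
        rw [smul_eq_mul, ← mul_assoc, hx]
    have hθ'' : ∀ u, θ (LinearMap.lTensor A (LinearMap.ker pr.toLinearMap).subtype u) = 0 := by
      intro u
      induction u with
      | zero => simp
      | tmul a j => exact hθ₃ j (Ideal.Quotient.eq_zero_iff_mem.1 j.2) a
      | add s t hs ht => rw [map_add, map_add, hs, ht, add_zero]
    have hθ₄ : ∀ t : A ⊗[k] H, Algebra.TensorProduct.map π pr t = 0 → θ t = 0 := by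
      intro t ht
      have hmem : t ∈ LinearMap.ker (TensorProduct.map π.toLinearMap pr.toLinearMap) := ht
      rw [TensorProduct.map_ker hker hπ (LinearMap.exact_subtype_ker_map pr.toLinearMap)
        (Ideal.Quotient.mkₐ_surjective k J)] at hmem
      obtain ⟨_, ⟨u, rfl⟩, _, ⟨v, rfl⟩, rfl⟩ := Submodule.mem_sup.1 hmem
      rw [map_add, hθ'' u, hθ' v, add_zero]
    rw [injective_iff_map_eq_zero]
    intro t ht
    obtain ⟨s, rfl⟩ := hqsurj t
    rw [hχq] at ht
    rw [← hθ, hθ₄ _ ht]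
  · intro t
    obtain ⟨u, rfl⟩ := TensorProduct.map_surjective (g := π.toLinearMap)
      (g' := (Ideal.Quotient.mkₐ k J).toLinearMap) hπ (Ideal.Quotient.mkₐ_surjective k J) t
    obtain ⟨s, rfl⟩ := hρ.2 u
    exact ⟨q s, hχq s⟩

end Galois

/-! ### The right `K`-module `N ⊗_B A` and the antipode twist -/

section Flat

variable {k H A A' : Type u} [Field k] [Ring H] [HopfAlgebra k H] [Ring A] [Algebra k A]
  [Ring A'] [Algebra k A'] {J : Ideal H} [J.IsTwoSided] [J.IsHopfIdeal k]
  {ρ : A →ₐ[k] A ⊗[k] H} {N : Type u} [AddCommGroup N]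

/-- The right `K`-module `N ⊗_B A`, on which `K` acts by right multiplication through
`g : K → A`. -/
@[nolint unusedArguments]
def TensorVia (B : Subalgebra k A) (_g : coinvH k J →ₐ[k] A) (N : Type u) [AddCommGroup N]
    [Module Bᵐᵒᵖ N] : Type u :=
  BalancedTensor B N A

namespace TensorVia

variable (B : Subalgebra k A) (g : coinvH k J →ₐ[k] A) [Module Bᵐᵒᵖ N]

instance : AddCommGroup (TensorVia B g N) :=
  inferInstanceAs (AddCommGroup (BalancedTensor B N A))

instance : Module (coinvH k J)ᵐᵒᵖ (TensorVia B g N) :=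
  BalancedTensor.rightModuleOfEnd N (rightMulEnd (S := B) (g : coinvH k J →+* A)
    fun r t t' => (smul_mul_assoc r t t').symm)

/-- The class of `n ⊗ a`, as a biadditive map. -/
def mk : N →+ A →+ TensorVia B g N := BalancedTensor.tmulHom B N A

theorem op_smul_mk (x : coinvH k J) (n : N) (a : A) :
    MulOpposite.op x • mk B g n a = mk B g n (a * g x) := rfl

theorem mk_smul (b : B) (n : N) (a : A) :
    mk B g (MulOpposite.op b • n) a = mk B g n (b * a) :=
  BalancedTensor.smul_tmul n b a

@[elab_as_elim]
theorem induction_on {motive : TensorVia B g N → Prop} (t : TensorVia B g N)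
    (mk : ∀ n p, motive (mk B g n p)) (add : ∀ s t, motive s → motive t → motive (s + t)) :
    motive t :=
  BalancedTensor.induction_on t mk add

/-- The universal property of `N ⊗_B A`. -/
def lift {G : Type*} [AddCommGroup G] (f : N →+ A →+ G)
    (hf : ∀ (n : N) (b : B) (p : A),
      f (MulOpposite.op b • n) p = f n (b * p)) : TensorVia B g N →+ G :=
  BalancedTensor.lift f hf

/-- The additive map induced by a homomorphism of right `B`-modules. -/
def mapHom {N' : Type u} [AddCommGroup N'] [Module Bᵐᵒᵖ N']
    (f : N →ₗ[Bᵐᵒᵖ] N') : TensorVia B g N →+ TensorVia B g N' :=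
  BalancedTensor.map A f

theorem mapHom_smul {N' : Type u} [AddCommGroup N'] [Module Bᵐᵒᵖ N']
    (f : N →ₗ[Bᵐᵒᵖ] N') (x : (coinvH k J)ᵐᵒᵖ) (t : TensorVia B g N) :
    mapHom B g f (x • t) = x • mapHom B g f t := by
  induction t using induction_on with
  | mk n a => rfl
  | add s t hs ht => rw [smul_add, map_add, hs, ht, map_add, smul_add]

/-- The map induced by a homomorphism of right `B`-modules. -/
def map {N' : Type u} [AddCommGroup N'] [Module Bᵐᵒᵖ N']
    (f : N →ₗ[Bᵐᵒᵖ] N') : TensorVia B g N →ₗ[(coinvH k J)ᵐᵒᵖ] TensorVia B g N' where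
  toFun := mapHom B g f
  map_add' := map_add _
  map_smul' := mapHom_smul B g f

theorem map_mk {N' : Type u} [AddCommGroup N'] [Module Bᵐᵒᵖ N']
    (f : N →ₗ[Bᵐᵒᵖ] N') (n : N) (a : A) :
    map B g f (mk B g n a) = mk B g (f n) a := rfl

/-- The map `A ⊗ H → (N ⊗_B A) ⊗_K H`, `a ⊗ h ↦ (n ⊗ a) ⊗ h`. -/
def insert (n : N) : A ⊗[k] H →+ BalancedTensor (coinvH k J) (TensorVia B g N) H :=
  TensorProduct.liftAddHom
    ((BalancedTensor.tmulHom (coinvH k J) (TensorVia B g N) H).comp (mk B g n)) fun c a h => by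
      have h1 : mk B g n (c • a) = MulOpposite.op (algebraMap k (coinvH k J) c) • mk B g n a := by
        rw [op_smul_mk, AlgHom.commutes, ← Algebra.commutes, Algebra.smul_def]
      simp only [AddMonoidHom.comp_apply, BalancedTensor.tmulHom_apply]
      rw [h1, BalancedTensor.smul_tmul, algebraMap_smul]

theorem insert_tmul (n : N) (a : A) (h : H) :
    insert B g n (a ⊗ₜ h) = BalancedTensor.tmul (coinvH k J) (mk B g n a) h := rfl

theorem insert_add (n n' : N) (u : A ⊗[k] H) :
    insert B g (n + n') u = insert B g n u + insert B g n' u := by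
  induction u with
  | zero => simp
  | tmul a h => simp only [insert_tmul, map_add, AddMonoidHom.add_apply, BalancedTensor.add_tmul]
  | add s t hs ht => rw [map_add, map_add, map_add, hs, ht]; abel

theorem insert_smul (b : B) (n : N) (u : A ⊗[k] H) :
    insert B g (MulOpposite.op b • n) u = insert B g n (((b : A) ⊗ₜ[k] (1 : H)) * u) := by
  induction u with
  | zero => simp
  | tmul a h => simp [insert_tmul, mk_smul]
  | add s t hs ht => rw [map_add, mul_add, map_add, hs, ht]

theorem map_insert {N' : Type u} [AddCommGroup N'] [Module Bᵐᵒᵖ N']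
    (f : N →ₗ[Bᵐᵒᵖ] N') (n : N) (u : A ⊗[k] H) :
    BalancedTensor.map H (map B g f) (insert B g n u) = insert B g (f n) u := by
  induction u with
  | zero => simp
  | tmul a h => rw [insert_tmul, insert_tmul, BalancedTensor.map_tmul, map_mk]
  | add s t hs ht => rw [map_add, map_add, map_add, hs, ht]

theorem induction_insert {motive : BalancedTensor (coinvH k J) (TensorVia B g N) H → Prop}
    (t : BalancedTensor (coinvH k J) (TensorVia B g N) H)
    (tmul : ∀ n a h, motive (insert B g n (a ⊗ₜ h)))
    (add : ∀ s t, motive s → motive t → motive (s + t)) : motive t := by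
  induction t using BalancedTensor.induction_on with
  | tmul v h =>
    induction v using induction_on with
    | mk n a => exact tmul n a h
    | add s t hs ht => rw [BalancedTensor.add_tmul]; exact add _ _ hs ht
  | add s t hs ht => exact add _ _ hs ht

end TensorVia

variable (ρ) in
/-- The map `A ⊗ H → A ⊗ H`, `a ⊗ h ↦ a₍₀₎ ⊗ S(a₍₁₎) h`. -/
def antipodeTwist : A ⊗[k] H →ₗ[k] A ⊗[k] H :=
  LinearMap.lTensor A (LinearMap.mul' k H ∘ₗ LinearMap.rTensor H (HopfAlgebra.antipode k)) ∘ₗ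
    (TensorProduct.assoc k A H H).toLinearMap ∘ₗ LinearMap.rTensor H ρ.toLinearMap

/-- The map `A ⊗ H → A ⊗ H`, `a ⊗ h' ↦ a ⊗ S(h') h`. -/
def antipodeMul (k A : Type u) {H : Type u} [Field k] [Ring H] [HopfAlgebra k H] [Ring A]
    [Algebra k A] (h : H) : A ⊗[k] H →ₗ[k] A ⊗[k] H :=
  LinearMap.lTensor A (LinearMap.mulRight k h ∘ₗ HopfAlgebra.antipode k)

theorem antipodeMul_tmul (a : A) (h h' : H) :
    antipodeMul k A h (a ⊗ₜ h') = a ⊗ₜ[k] (HopfAlgebra.antipode k h' * h) := rfl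

theorem antipodeTwist_tmul (a : A) (h : H) :
    antipodeTwist ρ (a ⊗ₜ h) = antipodeMul k A h (ρ a) := by
  simp only [antipodeTwist, antipodeMul, LinearMap.comp_apply, LinearMap.rTensor_tmul,
    AlgHom.toLinearMap_apply]
  generalize ρ a = u
  induction u with
  | zero => simp
  | tmul b h' => simp
  | add s t hs ht => simp only [TensorProduct.add_tmul, map_add, hs, ht]

/-- Since `ρ(b) = b ⊗ 1`, the antipode never meets `b`. This is what lets the twist descend to
tensor products balanced over the coinvariants. -/
theorem antipodeTwist_coinvariant_mul (b : coinvariants ρ) (u : A ⊗[k] H) :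
    antipodeTwist ρ (((b : A) ⊗ₜ[k] (1 : H)) * u) =
      ((b : A) ⊗ₜ[k] (1 : H)) * antipodeTwist ρ u := by
  have h1 : ∀ (h : H) (v : A ⊗[k] H), antipodeMul k A h (((b : A) ⊗ₜ[k] (1 : H)) * v) =
      ((b : A) ⊗ₜ[k] (1 : H)) * antipodeMul k A h v := by
    intro h v
    induction v with
    | zero => simp
    | tmul c h' => simp [antipodeMul_tmul]
    | add s t hs ht => simp only [mul_add, map_add, hs, ht]
  induction u with
  | zero => simp
  | tmul a h =>
    have hb : ρ (b : A) = (b : A) ⊗ₜ[k] (1 : H) := b.2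
    rw [Algebra.TensorProduct.tmul_mul_tmul, one_mul, antipodeTwist_tmul, antipodeTwist_tmul,
      map_mul, hb, h1]
  | add s t hs ht => simp only [mul_add, map_add, hs, ht]

/-- By coassociativity the left side is `a₍₀₎ ⊗ S(a₍₁₎) a₍₂₎ h`. The twist thus undoes `a ⊗ h ↦ a₍₀₎
⊗ a₍₁₎ h`, which is one half of the bijection `A ⊗_K H ≅ A' ⊗ H`. -/
theorem antipodeTwist_coaction_mul (hρ : IsRightCoaction ρ) (a : A) (h : H) :
    antipodeTwist ρ (ρ a * ((1 : A) ⊗ₜ[k] h)) = a ⊗ₜ[k] h := by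
  have h1 : ∀ u : A ⊗[k] H, antipodeTwist ρ (u * ((1 : A) ⊗ₜ[k] h)) =
      antipodeTwist ρ u * ((1 : A) ⊗ₜ[k] h) := by
    intro u
    induction u with
    | zero => simp
    | tmul c h' =>
      rw [Algebra.TensorProduct.tmul_mul_tmul, mul_one, antipodeTwist_tmul, antipodeTwist_tmul]
      generalize ρ c = v
      induction v with
      | zero => simp
      | tmul d h'' => simp [antipodeMul_tmul, mul_assoc]
      | add s t hs ht => simp only [add_mul, map_add, hs, ht]
    | add s t hs ht => simp only [add_mul, map_add, hs, ht]
  have h2 : antipodeTwist ρ (ρ a) = a ⊗ₜ[k] (1 : H) := by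
    have h3 : TensorProduct.assoc k A H H (LinearMap.rTensor H ρ.toLinearMap (ρ a)) =
        LinearMap.lTensor A Coalgebra.comul (ρ a) := hρ.coassoc a
    have h4 : LinearMap.lTensor A Coalgebra.counit (ρ a) = a ⊗ₜ[k] (1 : k) := hρ.counit a
    rw [antipodeTwist, LinearMap.comp_apply, LinearMap.comp_apply]
    erw [h3]
    rw [← LinearMap.comp_apply, ← LinearMap.lTensor_comp, LinearMap.comp_assoc,
      HopfAlgebra.mul_antipode_rTensor_comul, LinearMap.lTensor_comp, LinearMap.comp_apply, h4]
    simp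
  rw [h1, h2, Algebra.TensorProduct.tmul_mul_tmul, mul_one, one_mul]

/-- In `(N ⊗_B A) ⊗_K H`, the twist kills the augmentation of `K`. -/
theorem TensorVia.insert_antipodeTwist_mul {g : coinvH k J →ₐ[k] A}
    (hg : ∀ x, ρ (g x) = TensorProduct.map g.toLinearMap LinearMap.id (coinvCoaction k J x))
    (B : Subalgebra k A) [Module Bᵐᵒᵖ N] (n : N)
    (a : A) (x : coinvH k J) (h : H) :
    insert B g n (antipodeTwist ρ ((a * g x) ⊗ₜ h)) =
      insert B g n (antipodeTwist ρ ((Coalgebra.counit (R := k) (x : H) • a) ⊗ₜ h)) := by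
  -- For `t = y ⊗ z` one has `b g(y) ⊗ S(h'z)h = b ⊗ y S(z) S(h')h` over `K`. With `t = x₍₁₎ ⊗ x₍₂₎`
  -- the factor `x₍₁₎ S(x₍₂₎)` is `ε(x)`.
  have h1 : ∀ (b : A) (h' : H) (t : coinvH k J ⊗[k] H),
      insert B g n (antipodeMul k A h ((b ⊗ₜ h') * TensorProduct.map g.toLinearMap LinearMap.id t)) =
      insert B g n (b ⊗ₜ (LinearMap.mul' k H (LinearMap.lTensor H (HopfAlgebra.antipode k)
        (inclTensor k J t)) * (HopfAlgebra.antipode k h' * h))) := by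
    intro b h' t
    induction t with
    | zero => simp
    | tmul y z =>
      rw [TensorProduct.map_tmul, Algebra.TensorProduct.tmul_mul_tmul, antipodeMul_tmul,
        LinearMap.id_apply, HopfAlgebra.antipode_mul_antidistrib, insert_tmul, insert_tmul,
        AlgHom.toLinearMap_apply, ← op_smul_mk, BalancedTensor.smul_tmul, Subalgebra.smul_def]
      simp [inclTensor, mul_assoc]
    | add s t hs ht => simp only [map_add, mul_add, add_mul, TensorProduct.tmul_add, hs, ht]
  rw [antipodeTwist_tmul, antipodeTwist_tmul, map_mul, hg, map_smul, map_smul]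
  generalize ρ a = u
  induction u with
  | zero => simp
  | tmul b h' =>
    rw [h1, inclTensor_coinvCoaction, HopfAlgebra.mul_antipode_lTensor_comul_apply,
      antipodeMul_tmul, ← TensorProduct.tmul_smul, Algebra.smul_def]
  | add s t hs ht => rw [add_mul, map_add, map_add, hs, ht, ← map_add, ← smul_add, ← map_add]

end Flat

/-! ### Maps between `N ⊗_C A'` and `(N ⊗_B A) ⊗_K H` -/

section Flat

variable {k H A A' : Type u} [Field k] [Ring H] [HopfAlgebra k H] [Ring A] [Algebra k A]
  [Ring A'] [Algebra k A'] {J : Ideal H} [J.IsTwoSided] [J.IsHopfIdeal k]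
  {ρ : A →ₐ[k] A ⊗[k] H} {g : coinvH k J →ₐ[k] A} {π : A →ₐ[k] A'}
  {C : Type u} [Ring C] [Module C A'] {p : coinvariants ρ →+* C}
  {N : Type u} [AddCommGroup N] [Module Cᵐᵒᵖ N] [Module (coinvariants ρ)ᵐᵒᵖ N]

/-- The map `N ⊗_C A' → (N ⊗_B A) ⊗_K H`, `n ⊗ π(a) ↦ (n ⊗ a₍₀₎) ⊗ S(a₍₁₎) h`. -/
theorem exists_insert_antipodeTwist
    (hg : ∀ x, ρ (g x) = TensorProduct.map g.toLinearMap LinearMap.id (coinvCoaction k J x))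
    (hπ : Function.Surjective π)
    (hker : ∀ a, π a = 0 →
      a ∈ Ideal.span {a | ∃ x : coinvH k J, Coalgebra.counit (R := k) (x : H) = 0 ∧ g x = a})
    (hp : Function.Surjective p) (hl : ∀ (b : coinvariants ρ) a, p b • π a = π (b * a))
    (hN : ∀ (b : coinvariants ρ) (n : N), MulOpposite.op b • n = MulOpposite.op (p b) • n)
    (h : H) :
    ∃ Φ : BalancedTensor C N A' →+
        BalancedTensor (coinvH k J) (TensorVia (coinvariants ρ) g N) H,
      ∀ n a, Φ (BalancedTensor.tmul C n (π a)) =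
        TensorVia.insert (coinvariants ρ) g n (antipodeTwist ρ (a ⊗ₜ h)) := by
  let e (n : N) : A →+ BalancedTensor (coinvH k J) (TensorVia (coinvariants ρ) g N) H :=
    (TensorVia.insert (coinvariants ρ) g n).comp
      ((antipodeTwist ρ).toAddMonoidHom.comp ((TensorProduct.mk k A H).flip h).toAddMonoidHom)
  have he : ∀ n a, e n a =
    TensorVia.insert (coinvariants ρ) g n (antipodeTwist ρ (a ⊗ₜ h)) := fun _ _ => rfl
  have he₀ : ∀ n, (π : A →+ A').ker ≤ (e n).ker := by
    intro n a ha
    have ha' := hker a ha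
    clear ha
    -- The kernel of `π` is only known as a left ideal with generators `g(x)`; allowing a left
    -- factor `c` makes the induction go through.
    suffices ∀ c, e n (c * a) = 0 by simpa using this 1
    induction ha' using Submodule.span_induction with
    | mem a ha =>
      obtain ⟨x, hx, rfl⟩ := ha
      intro c
      rw [he, TensorVia.insert_antipodeTwist_mul hg, hx]
      simp
    | zero => simp
    | add a b _ _ ha hb =>
      intro c
      rw [mul_add, map_add, ha, hb, add_zero]
    | smul d a _ ha =>
      intro c
      rw [smul_eq_mul, ← mul_assoc, ha]
  let E (n : N) : A' →+ BalancedTensor (coinvH k J) (TensorVia (coinvariants ρ) g N) H :=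
    (π : A →+ A').liftOfSurjective hπ ⟨e n, he₀ n⟩
  have hE : ∀ n a, E n (π a) = e n a := fun n a =>
    AddMonoidHom.liftOfRightInverse_comp_apply _ _ _ ⟨e n, he₀ n⟩ a
  refine ⟨BalancedTensor.lift (AddMonoidHom.mk' E fun n n' => AddMonoidHom.ext fun a => ?_) ?_, ?_⟩
  · obtain ⟨a, rfl⟩ := hπ a
    rw [AddMonoidHom.add_apply, hE, hE, hE, he, he, he, TensorVia.insert_add]
  · intro n c a
    obtain ⟨a, rfl⟩ := hπ a
    obtain ⟨b, rfl⟩ := hp c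
    rw [hl, ← hN]
    change E _ _ = E _ _
    rw [hE, hE, he, he, TensorVia.insert_smul, ← antipodeTwist_coinvariant_mul,
      Algebra.TensorProduct.tmul_mul_tmul, one_mul]
  · intro n a
    rw [BalancedTensor.lift_tmul]
    exact hE n a

theorem eq_counit_of_trivial (hπg : ∀ x : coinvH k J, Coalgebra.counit (R := k) (x : H) = 0 →
      π (g x) = 0) (x : coinvH k J) : π (g x) = algebraMap k A' (Coalgebra.counit (x : H)) := by
  have := hπg (x - algebraMap k _ (Coalgebra.counit (x : H))) (by simp)
  rwa [map_sub, map_sub, AlgHom.commutes, AlgHom.commutes, sub_eq_zero] at this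

/-- The map `(N ⊗_B A) ⊗_K H → N ⊗_C A'`, `(n ⊗ a) ⊗ h ↦ ε(h) n ⊗ π(a)`. -/
theorem exists_counit_retraction
    (hπg : ∀ x : coinvH k J, Coalgebra.counit (R := k) (x : H) = 0 → π (g x) = 0)
    (hl : ∀ (b : coinvariants ρ) a, p b • π a = π (b * a))
    (hN : ∀ (b : coinvariants ρ) (n : N), MulOpposite.op b • n = MulOpposite.op (p b) • n) :
    ∃ r : BalancedTensor (coinvH k J) (TensorVia (coinvariants ρ) g N) H →+
        BalancedTensor C N A',
      ∀ n a h, r (TensorVia.insert (coinvariants ρ) g n (a ⊗ₜ h)) =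
        BalancedTensor.tmul C n (π (Coalgebra.counit (R := k) h • a)) := by
  let r₁ : TensorVia (coinvariants ρ) g N →+ H →+ BalancedTensor C N A' :=
    TensorVia.lift (coinvariants ρ) g
      (AddMonoidHom.mk' (fun n => AddMonoidHom.mk' (fun a => AddMonoidHom.mk' (fun h =>
          BalancedTensor.tmul C n (π (Coalgebra.counit (R := k) h • a)))
        fun h h' => by rw [map_add, add_smul, map_add, BalancedTensor.tmul_add])
        fun a a' => AddMonoidHom.ext fun h => by simp [BalancedTensor.tmul_add])
        fun n n' => AddMonoidHom.ext fun a => AddMonoidHom.ext fun h => by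
          simp [BalancedTensor.add_tmul])
      fun n b a => AddMonoidHom.ext fun h => by
        change BalancedTensor.tmul C _ _ = BalancedTensor.tmul C _ _
        rw [hN, BalancedTensor.smul_tmul, hl, mul_smul_comm]
  have hr₁ : ∀ n a h, r₁ (TensorVia.mk (coinvariants ρ) g n a) h =
    BalancedTensor.tmul C n (π (Coalgebra.counit (R := k) h • a)) := fun _ _ _ => rfl
  refine ⟨BalancedTensor.lift r₁ ?_, fun n a h => rfl⟩
  intro v x h
  induction v using TensorVia.induction_on with
  | mk n a =>
    -- Balancedness over `K`: on one side `x` contributes `π(g(x)) = ε(x)`, on the other `ε(xh) =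
    -- ε(x) ε(h)`.
    rw [TensorVia.op_smul_mk, hr₁, hr₁, map_smul, map_mul, eq_counit_of_trivial hπg,
      ← Algebra.commutes, ← Algebra.smul_def, smul_smul, Subalgebra.smul_def, smul_eq_mul,
      Bialgebra.counit_mul, mul_comm, map_smul]
  | add s t hs ht => rw [smul_add, map_add, map_add, AddMonoidHom.add_apply,
      AddMonoidHom.add_apply, hs, ht]

/-- The map `(N ⊗_B A) ⊗_K H → (N ⊗_C A') ⊗ H`, `(n ⊗ a) ⊗ h ↦ n ⊗ π(a₍₀₎) ⊗ a₍₁₎ h`, in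
coordinates with respect to a basis of `H`. -/
theorem exists_coordinates {I : Type*} (β : Module.Basis I k H)
    (hg : ∀ x, ρ (g x) = TensorProduct.map g.toLinearMap LinearMap.id (coinvCoaction k J x))
    (hπ : Function.Surjective π)
    (hπg : ∀ x : coinvH k J, Coalgebra.counit (R := k) (x : H) = 0 → π (g x) = 0)
    (hl : ∀ (b : coinvariants ρ) a, p b • π a = π (b * a))
    (hN : ∀ (b : coinvariants ρ) (n : N), MulOpposite.op b • n = MulOpposite.op (p b) • n) :
    ∃ c : BalancedTensor (coinvH k J) (TensorVia (coinvariants ρ) g N) H →+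
        I →₀ BalancedTensor C N A',
      ∀ n a h, c (TensorVia.insert (coinvariants ρ) g n (a ⊗ₜ h)) =
        Finsupp.mapRange.addMonoidHom (BalancedTensor.tmulHom C N A' n)
          ((Algebra.TensorProduct.basis A' β).repr (Algebra.TensorProduct.map π (AlgHom.id k H)
            (ρ a * ((1 : A) ⊗ₜ[k] h)))) := by
  -- A basis of `H` over `k` is a basis of `A' ⊗ H` over `A'`. Working with coefficients represents
  -- `(N ⊗_C A') ⊗ H` without a `k`-structure on `N`.
  let T (n : N) : A' ⊗[k] H →+ I →₀ BalancedTensor C N A' :=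
    (Finsupp.mapRange.addMonoidHom (BalancedTensor.tmulHom C N A' n)).comp
      (Algebra.TensorProduct.basis A' β).repr.toLinearMap.toAddMonoidHom
  have hT : ∀ n u, T n u = Finsupp.mapRange.addMonoidHom (BalancedTensor.tmulHom C N A' n)
    ((Algebra.TensorProduct.basis A' β).repr u) := fun _ _ => rfl
  have hTb : ∀ (b : coinvariants ρ) n u, T (MulOpposite.op b • n) u =
      T n ((π (b : A) ⊗ₜ[k] (1 : H)) * u) := by
    intro b n u
    have h1 : (π (b : A) ⊗ₜ[k] (1 : H)) * u = π (b : A) • u := by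
      induction u with
      | zero => simp
      | tmul x y => simp [TensorProduct.smul_tmul']
      | add s t hs ht => rw [mul_add, smul_add, hs, ht]
    rw [hT, hT, h1, LinearEquiv.map_smul]
    ext j
    obtain ⟨a, ha⟩ := hπ ((Algebra.TensorProduct.basis A' β).repr u j)
    simp only [Finsupp.mapRange.addMonoidHom_apply, Finsupp.mapRange_apply, Finsupp.smul_apply,
      BalancedTensor.tmulHom_apply, smul_eq_mul, ← ha]
    rw [hN, BalancedTensor.smul_tmul, hl, map_mul]
  let c₁ : TensorVia (coinvariants ρ) g N →+ H →+ I →₀ BalancedTensor C N A' :=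
    TensorVia.lift (coinvariants ρ) g
      (AddMonoidHom.mk' (fun n => AddMonoidHom.mk' (fun a => AddMonoidHom.mk' (fun h =>
          T n (Algebra.TensorProduct.map π (AlgHom.id k H) (ρ a * ((1 : A) ⊗ₜ[k] h))))
        fun h h' => by rw [TensorProduct.tmul_add, mul_add, map_add, map_add])
        fun a a' => AddMonoidHom.ext fun h => by simp only [map_add, add_mul]; rfl)
        fun n n' => AddMonoidHom.ext fun a => AddMonoidHom.ext fun h => by
          ext j
          simp [hT])
      fun n b a => AddMonoidHom.ext fun h => by
        change T _ _ = T _ _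
        have hb : ρ (b : A) = (b : A) ⊗ₜ[k] (1 : H) := b.2
        rw [hTb, map_mul ρ, hb, mul_assoc, map_mul _ ((b : A) ⊗ₜ[k] (1 : H)),
          Algebra.TensorProduct.map_tmul, map_one]
  have hc₁ : ∀ n a h, c₁ (TensorVia.mk (coinvariants ρ) g n a) h =
    T n (Algebra.TensorProduct.map π (AlgHom.id k H) (ρ a * ((1 : A) ⊗ₜ[k] h))) := fun _ _ _ => rfl
  refine ⟨BalancedTensor.lift c₁ ?_, fun n a h => rfl⟩
  intro v x h
  induction v using TensorVia.induction_on with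
  | mk n a =>
    -- Balancedness over `K`: `ψ` turns `ρ(g(x))` into `1 ⊗ x`, which is absorbed into the factor `1
    -- ⊗ h`.
    let ψ := Algebra.TensorProduct.map π (AlgHom.id k H)
    rw [TensorVia.op_smul_mk, hc₁, hc₁, map_mul ρ, map_mul ψ, map_mul ψ,
      map_coaction_of_trivial hg hπg, map_mul ψ, mul_assoc]
    simp [ψ, Subalgebra.smul_def]
  | add s t hs ht => rw [smul_add, map_add, map_add, AddMonoidHom.add_apply,
      AddMonoidHom.add_apply, hs, ht]

end Flat

/-! ### Faithful flatness of the quotient -/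

section Flat

variable {k H A A' : Type u} [Field k] [Ring H] [HopfAlgebra k H] [Ring A] [Algebra k A]
  [Ring A'] [Algebra k A'] {J : Ideal H} [J.IsTwoSided] [J.IsHopfIdeal k]
  {ρ : A →ₐ[k] A ⊗[k] H} {g : coinvH k J →ₐ[k] A} {π : A →ₐ[k] A'}
  {C : Type u} [Ring C] [Module C A'] {p : coinvariants ρ →+* C}

/-- Summing the maps `Φ j` over the coordinates applies the antipode twist to `ρ(a)(1 ⊗ h)`, and
that returns `a ⊗ h` by `antipodeTwist_coaction_mul`. So `(N ⊗_B A) ⊗_K H` is a retract of a sum of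
copies of `N ⊗_C A'`. -/
theorem sum_coordinates (hρ : IsRightCoaction ρ) {I : Type*} (β : Module.Basis I k H)
    {N : Type u} [AddCommGroup N] [Module Cᵐᵒᵖ N] [Module (coinvariants ρ)ᵐᵒᵖ N]
    {c : BalancedTensor (coinvH k J) (TensorVia (coinvariants ρ) g N) H →+
      I →₀ BalancedTensor C N A'}
    (hc : ∀ n a h, c (TensorVia.insert (coinvariants ρ) g n (a ⊗ₜ h)) =
        Finsupp.mapRange.addMonoidHom (BalancedTensor.tmulHom C N A' n)
          ((Algebra.TensorProduct.basis A' β).repr (Algebra.TensorProduct.map π (AlgHom.id k H)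
            (ρ a * ((1 : A) ⊗ₜ[k] h)))))
    {Φ : I → BalancedTensor C N A' →+
        BalancedTensor (coinvH k J) (TensorVia (coinvariants ρ) g N) H}
    (hΦ : ∀ j n a, Φ j (BalancedTensor.tmul C n (π a)) =
        TensorVia.insert (coinvariants ρ) g n (antipodeTwist ρ (a ⊗ₜ β j)))
    (t : BalancedTensor (coinvH k J) (TensorVia (coinvariants ρ) g N) H) :
    (c t).sum (fun j x => Φ j x) = t := by
  let total : (I →₀ BalancedTensor C N A') →+
      BalancedTensor (coinvH k J) (TensorVia (coinvariants ρ) g N) H :=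
    Finsupp.liftAddHom Φ
  change total (c t) = t
  have h1 : ∀ (n : N) (h : H) (a : A),
      total (Finsupp.mapRange.addMonoidHom (BalancedTensor.tmulHom C N A' n)
        ((Algebra.TensorProduct.basis A' β).repr (Algebra.TensorProduct.map π (AlgHom.id k H)
          (a ⊗ₜ h)))) = TensorVia.insert (coinvariants ρ) g n (antipodeTwist ρ (a ⊗ₜ h)) := by
    intro n h
    induction β.mem_span h using Submodule.span_induction with
    | mem h hh =>
      obtain ⟨j, rfl⟩ := hh
      intro a
      have h2 : Algebra.TensorProduct.map π (AlgHom.id k H) (a ⊗ₜ β j) =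
          π a • Algebra.TensorProduct.basis A' β j := by
        rw [Algebra.TensorProduct.basis_apply, TensorProduct.smul_tmul', smul_eq_mul, mul_one]
        rfl
      rw [h2, LinearEquiv.map_smul, Module.Basis.repr_self, Finsupp.smul_single, smul_eq_mul,
        mul_one, Finsupp.mapRange.addMonoidHom_apply, Finsupp.mapRange_single]
      simp only [total, Finsupp.liftAddHom_apply_single]
      exact hΦ j n a
    | zero => simp
    | add x y _ _ hx hy =>
      intro a
      simp only [TensorProduct.tmul_add, map_add, hx, hy]
    | smul d x _ hx =>
      intro a
      rw [← TensorProduct.smul_tmul, hx]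
  have h2 : ∀ (n : N) (u : A ⊗[k] H),
      total (Finsupp.mapRange.addMonoidHom (BalancedTensor.tmulHom C N A' n)
        ((Algebra.TensorProduct.basis A' β).repr (Algebra.TensorProduct.map π (AlgHom.id k H)
          u))) = TensorVia.insert (coinvariants ρ) g n (antipodeTwist ρ u) := by
    intro n u
    induction u with
    | zero => simp
    | tmul a h => exact h1 n h a
    | add s t hs ht => simp only [map_add, hs, ht]
  induction t using TensorVia.induction_insert with
  | tmul n a h => rw [hc, h2, antipodeTwist_coaction_mul hρ]
  | add s t hs ht => rw [map_add, map_add, hs, ht]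

/-- Because `ε ∘ S = ε`, the counit turns `a₍₀₎ ⊗ S(a₍₁₎)` back into `a`. So `N ⊗_C A'` is a retract
of `(N ⊗_B A) ⊗_K H`. -/
theorem retraction_insert (hρ : IsRightCoaction ρ)
    {N : Type u} [AddCommGroup N] [Module Cᵐᵒᵖ N] [Module (coinvariants ρ)ᵐᵒᵖ N]
    {r : BalancedTensor (coinvH k J) (TensorVia (coinvariants ρ) g N) H →+ BalancedTensor C N A'}
    (hr : ∀ n a h, r (TensorVia.insert (coinvariants ρ) g n (a ⊗ₜ h)) =
        BalancedTensor.tmul C n (π (Coalgebra.counit (R := k) h • a))) (n : N) (a : A) :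
    r (TensorVia.insert (coinvariants ρ) g n (antipodeTwist ρ (a ⊗ₜ (1 : H)))) =
      BalancedTensor.tmul C n (π a) := by
  have h1 : ∀ u : A ⊗[k] H, r (TensorVia.insert (coinvariants ρ) g n (antipodeMul k A 1 u)) =
      BalancedTensor.tmul C n (π (TensorProduct.rid k A
        (TensorProduct.map LinearMap.id Coalgebra.counit u))) := by
    intro u
    induction u with
    | zero => simp
    | tmul a h => simp [antipodeMul_tmul, hr]
    | add s t hs ht => simp only [map_add, hs, ht, BalancedTensor.tmul_add]
  rw [antipodeTwist_tmul, h1, hρ.counit, TensorProduct.rid_tmul, one_smul]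

/-- Exactness after tensoring with the quotient `A'` is the same as exactness after tensoring with
`A` and then with `H`. -/
theorem exact_quotient_iff (hρ : IsRightCoaction ρ)
    (hg : ∀ x, ρ (g x) = TensorProduct.map g.toLinearMap LinearMap.id (coinvCoaction k J x))
    (hπ : Function.Surjective π)
    (hπg : ∀ x : coinvH k J, Coalgebra.counit (R := k) (x : H) = 0 → π (g x) = 0)
    (hker : ∀ a, π a = 0 →
      a ∈ Ideal.span {a | ∃ x : coinvH k J, Coalgebra.counit (R := k) (x : H) = 0 ∧ g x = a})
    (hp : Function.Surjective p) (hl : ∀ (b : coinvariants ρ) a, p b • π a = π (b * a))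
    {N₁ N₂ N₃ : Type u} [AddCommGroup N₁] [AddCommGroup N₂] [AddCommGroup N₃]
    [Module Cᵐᵒᵖ N₁] [Module Cᵐᵒᵖ N₂] [Module Cᵐᵒᵖ N₃] [Module (coinvariants ρ)ᵐᵒᵖ N₁]
    [Module (coinvariants ρ)ᵐᵒᵖ N₂] [Module (coinvariants ρ)ᵐᵒᵖ N₃]
    (hN₁ : ∀ (b : coinvariants ρ) (n : N₁), MulOpposite.op b • n = MulOpposite.op (p b) • n)
    (hN₂ : ∀ (b : coinvariants ρ) (n : N₂), MulOpposite.op b • n = MulOpposite.op (p b) • n)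
    (hN₃ : ∀ (b : coinvariants ρ) (n : N₃), MulOpposite.op b • n = MulOpposite.op (p b) • n)
    (φ : N₁ →ₗ[Cᵐᵒᵖ] N₂) (ψ : N₂ →ₗ[Cᵐᵒᵖ] N₃)
    (φ' : N₁ →ₗ[(coinvariants ρ)ᵐᵒᵖ] N₂) (ψ' : N₂ →ₗ[(coinvariants ρ)ᵐᵒᵖ] N₃)
    (hφ : ∀ n, φ' n = φ n) (hψ : ∀ n, ψ' n = ψ n) :
    Function.Exact (BalancedTensor.map H (TensorVia.map (coinvariants ρ) g φ'))
      (BalancedTensor.map H (TensorVia.map (coinvariants ρ) g ψ')) ↔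
    Function.Exact (BalancedTensor.map A' φ) (BalancedTensor.map A' ψ) := by
  constructor
  · obtain ⟨i₁, hi₁⟩ := exists_insert_antipodeTwist (N := N₁) hg hπ hker hp hl hN₁ 1
    obtain ⟨i₂, hi₂⟩ := exists_insert_antipodeTwist (N := N₂) hg hπ hker hp hl hN₂ 1
    obtain ⟨i₃, hi₃⟩ := exists_insert_antipodeTwist (N := N₃) hg hπ hker hp hl hN₃ 1
    obtain ⟨r₁, hr₁⟩ := exists_counit_retraction (N := N₁) hπg hl hN₁
    obtain ⟨r₂, hr₂⟩ := exists_counit_retraction (N := N₂) hπg hl hN₂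
    obtain ⟨r₃, hr₃⟩ := exists_counit_retraction (N := N₃) hπg hl hN₃
    -- A single copy suffices in this direction: the twist with `h = 1` is a section of the counit
    -- map.
    refine exact_of_locallyFinite_retract (ι := Unit)
      ((Finsupp.singleAddHom ()).comp i₁) ((Finsupp.singleAddHom ()).comp i₂)
      ((Finsupp.singleAddHom ()).comp i₃) (fun _ => r₁) (fun _ => r₂) (fun _ => r₃) ?_ ?_ ?_ ?_ ?_
    · rintro t ⟨⟩
      simp only [AddMonoidHom.comp_apply, Finsupp.singleAddHom_apply, Finsupp.single_eq_same]
      induction t using BalancedTensor.induction_on with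
      | tmul n a =>
        obtain ⟨a, rfl⟩ := hπ a
        rw [BalancedTensor.map_tmul, hi₂, hi₁]
        erw [TensorVia.map_insert]
        rw [hφ]
      | add s t hs ht => simp only [map_add, hs, ht]
    · rintro t ⟨⟩
      simp only [AddMonoidHom.comp_apply, Finsupp.singleAddHom_apply, Finsupp.single_eq_same]
      induction t using BalancedTensor.induction_on with
      | tmul n a =>
        obtain ⟨a, rfl⟩ := hπ a
        rw [BalancedTensor.map_tmul, hi₃, hi₂]
        erw [TensorVia.map_insert]
        rw [hψ]
      | add s t hs ht => simp only [map_add, hs, ht]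
    · rintro - t
      induction t using TensorVia.induction_insert with
      | tmul n a h =>
        rw [TensorVia.map_insert, hr₁, hr₂, hφ]
        rfl
      | add s t hs ht => simp only [map_add, hs, ht]
    · intro t
      simp only [AddMonoidHom.comp_apply, Finsupp.singleAddHom_apply]
      rw [Finsupp.sum_single_index (h := fun _ x => r₂ x) (map_zero r₂)]
      induction t using BalancedTensor.induction_on with
      | tmul n a =>
        obtain ⟨a, rfl⟩ := hπ a
        rw [hi₂, retraction_insert hρ hr₂]
      | add s t hs ht => simp only [map_add, hs, ht]
    · intro t
      simp only [AddMonoidHom.comp_apply, Finsupp.singleAddHom_apply]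
      rw [Finsupp.sum_single_index (h := fun _ x => r₃ x) (map_zero r₃)]
      induction t using BalancedTensor.induction_on with
      | tmul n a =>
        obtain ⟨a, rfl⟩ := hπ a
        rw [hi₃, retraction_insert hρ hr₃]
      | add s t hs ht => simp only [map_add, hs, ht]
  -- In the converse direction the copies are indexed by a basis of `H`, with one twist for each
  -- basis vector.
  · let β := Module.Basis.ofVectorSpace k H
    choose i₁ hi₁ using
      fun j => exists_insert_antipodeTwist (N := N₁) hg hπ hker hp hl hN₁ (β j)
    choose i₂ hi₂ using
      fun j => exists_insert_antipodeTwist (N := N₂) hg hπ hker hp hl hN₂ (β j)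
    choose i₃ hi₃ using
      fun j => exists_insert_antipodeTwist (N := N₃) hg hπ hker hp hl hN₃ (β j)
    obtain ⟨c₁, hc₁⟩ := exists_coordinates (N := N₁) β hg hπ hπg hl hN₁
    obtain ⟨c₂, hc₂⟩ := exists_coordinates (N := N₂) β hg hπ hπg hl hN₂
    obtain ⟨c₃, hc₃⟩ := exists_coordinates (N := N₃) β hg hπ hπg hl hN₃
    refine exact_of_locallyFinite_retract c₁ c₂ c₃ i₁ i₂ i₃ ?_ ?_ ?_ ?_ ?_
    · intro t j
      induction t using TensorVia.induction_insert with
      | tmul n a h =>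
        rw [TensorVia.map_insert, hc₁, hc₂, hφ]
        rfl
      | add s t hs ht => simp only [map_add, Finsupp.add_apply, hs, ht]
    · intro t j
      induction t using TensorVia.induction_insert with
      | tmul n a h =>
        rw [TensorVia.map_insert, hc₂, hc₃, hψ]
        rfl
      | add s t hs ht => simp only [map_add, Finsupp.add_apply, hs, ht]
    · intro j t
      induction t using BalancedTensor.induction_on with
      | tmul n a =>
        obtain ⟨a, rfl⟩ := hπ a
        rw [BalancedTensor.map_tmul, hi₂, hi₁, TensorVia.map_insert, hφ]
      | add s t hs ht => simp only [map_add, hs, ht]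
    · exact sum_coordinates hρ β hc₂ hi₂
    · exact sum_coordinates hρ β hc₃ hi₃

/-- The quotient `A' = A / A g(K ∩ ker ε)` is faithfully flat over the coinvariants of `A`. -/
theorem FaithfullyFlat.of_quotient (hρ : IsRightCoaction ρ)
    (hA : FaithfullyFlat (coinvariants ρ) A) (hH : FaithfullyFlat (coinvH k J) H)
    (hg : ∀ x, ρ (g x) = TensorProduct.map g.toLinearMap LinearMap.id (coinvCoaction k J x))
    (hπ : Function.Surjective π)
    (hπg : ∀ x : coinvH k J, Coalgebra.counit (R := k) (x : H) = 0 → π (g x) = 0)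
    (hker : ∀ a, π a = 0 →
      a ∈ Ideal.span {a | ∃ x : coinvH k J, Coalgebra.counit (R := k) (x : H) = 0 ∧ g x = a})
    (hp : Function.Surjective p) (hl : ∀ (b : coinvariants ρ) a, p b • π a = π (b * a)) :
    FaithfullyFlat C A' := by
  intro N₁ N₂ N₃ _ _ _ _ _ _ φ ψ
  let _ : Module (coinvariants ρ)ᵐᵒᵖ N₁ := Module.compHom N₁ (RingHom.op p)
  let _ : Module (coinvariants ρ)ᵐᵒᵖ N₂ := Module.compHom N₂ (RingHom.op p)
  let _ : Module (coinvariants ρ)ᵐᵒᵖ N₃ := Module.compHom N₃ (RingHom.op p)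
  let φ' : N₁ →ₗ[(coinvariants ρ)ᵐᵒᵖ] N₂ :=
    { toFun := φ
      map_add' := map_add φ
      map_smul' := fun b n => φ.map_smul (RingHom.op p b) n }
  let ψ' : N₂ →ₗ[(coinvariants ρ)ᵐᵒᵖ] N₃ :=
    { toFun := ψ
      map_add' := map_add ψ
      map_smul' := fun b n => ψ.map_smul (RingHom.op p b) n }
  have h1 : Function.Exact φ ψ ↔ Function.Exact (TensorVia.map (coinvariants ρ) g φ')
      (TensorVia.map (coinvariants ρ) g ψ') := hA N₁ N₂ N₃ φ' ψ'
  -- Exactness is tested first over `B` with `A`, then over `K` with `H`; what remains is the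
  -- comparison with `A'`.
  rw [h1, hH _ _ _ (TensorVia.map (coinvariants ρ) g φ') (TensorVia.map (coinvariants ρ) g ψ')]
  exact exact_quotient_iff hρ hg hπ hπg hker hp hl (fun _ _ => rfl) (fun _ _ => rfl)
    (fun _ _ => rfl) φ ψ φ' ψ' (fun _ => rfl) (fun _ => rfl)

end Flat

/-! ### The quotient as a principal comodule algebra -/

section Reduction

variable {k H A A' : Type u} [Field k] [Ring H] [HopfAlgebra k H] [Ring A] [Algebra k A]
  [Ring A'] [Algebra k A'] {J : Ideal H} [J.IsTwoSided] [J.IsHopfIdeal k]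
  {ρ : A →ₐ[k] A ⊗[k] H} {π : A →ₐ[k] A'} {ρ' : A' →ₐ[k] A' ⊗[k] (H ⧸ J)}

theorem map_coinvariants_le
    (hρ' : ∀ a, ρ' (π a) = Algebra.TensorProduct.map π (Ideal.Quotient.mkₐ k J) (ρ a))
    {b : A} (hb : b ∈ coinvariants ρ) : π b ∈ coinvariants ρ' := by
  have hb' : ρ b = b ⊗ₜ[k] (1 : H) := hb
  rw [mem_coinvariants, hρ', hb', Algebra.TensorProduct.map_tmul, map_one]

/-- The coinvariants of the quotient `A' = A / A g(K ∩ ker ε)` are those of `A`. -/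
theorem coinvariants_of_quotient (hJ : IsLeftPrincipal (quotientCoaction k J))
    (hρ : IsPrincipal ρ) {g : coinvH k J →ₐ[k] A}
    (hg : ∀ x, ρ (g x) = TensorProduct.map g.toLinearMap LinearMap.id (coinvCoaction k J x))
    (hπ : Function.Surjective π)
    (hπg : ∀ x : coinvH k J, Coalgebra.counit (R := k) (x : H) = 0 → π (g x) = 0)
    (hker : ∀ a, π a = 0 →
      a ∈ Ideal.span {a | ∃ x : coinvH k J, Coalgebra.counit (R := k) (x : H) = 0 ∧ g x = a})
    (hρ' : ∀ a, ρ' (π a) = Algebra.TensorProduct.map π (Ideal.Quotient.mkₐ k J) (ρ a)) :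
    (coinvariants ρ).map π = coinvariants ρ' ∧ ∀ b ∈ coinvariants ρ, π b = 0 → b = 0 := by
  let j : coinvariants ρ →+* A' := (π.comp (coinvariants ρ).val : coinvariants ρ →+* A')
  let _ : Module (coinvariants ρ) A' := Module.compHom A' j
  let _ : Module (coinvariants ρ)ᵐᵒᵖ A' := Module.compHom A' (RingHom.op j)
  have hl : ∀ (r : coinvariants ρ) (t : A'), r • t = j r * t := fun _ _ => rfl
  have hr : ∀ (r : coinvariants ρ) (t : A'), MulOpposite.op r • t = t * j r := fun _ _ => rfl
  -- The coinvariants of `A'` are not yet identified, so flatness and the Galois property are first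
  -- used over `B` itself.
  have hff : FaithfullyFlat (coinvariants ρ) A' :=
    FaithfullyFlat.of_quotient (p := RingHom.id _) hρ.coaction hρ.flat hJ.flat hg hπ hπg hker
      Function.surjective_id fun b a => (map_mul π (b : A) a).symm
  let χ : BalancedTensor (coinvariants ρ) A' A' →+ A' ⊗[k] (H ⧸ J) :=
    BalancedTensor.lift
      ((AddMonoidHom.compl₂ (AddMonoidHom.mul (R := A' ⊗[k] (H ⧸ J)))
        (ρ' : A' →+ A' ⊗[k] (H ⧸ J))).comp
        ((Algebra.TensorProduct.includeLeft : A' →ₐ[k] A' ⊗[k] (H ⧸ J)) :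
          A' →+ A' ⊗[k] (H ⧸ J))) fun a b c => by
      have hb : ρ' (j b) = j b ⊗ₜ[k] (1 : H ⧸ J) := map_coinvariants_le hρ' b.2
      simp [hl, hr, hb, ← mul_assoc]
  have hχ : ∀ a b, χ (BalancedTensor.tmul _ a b) = (a ⊗ₜ[k] 1) * ρ' b := fun _ _ => rfl
  have hinj := (galois_of_quotient hJ.galois.1 hρ.galois hg hπ hπg hρ' id
    (fun b a => (map_mul π (b : A) a).symm) (fun b a => (map_mul π a (b : A)).symm) χ hχ).1
  constructor
  · apply le_antisymm
    · rintro _ ⟨b, hb, rfl⟩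
      exact map_coinvariants_le hρ' hb
    · intro a ha
      have ha' : ρ' a = a ⊗ₜ[k] (1 : H ⧸ J) := ha
      -- Both tensors have image `a ⊗ 1`, since `χ (1 ⊗ a) = ρ'(a)` and `a` is coinvariant. Descent
      -- then puts `a` in the image of `B`.
      have h1 : BalancedTensor.tmul (coinvariants ρ) a 1 = BalancedTensor.tmul _ 1 a := by
        apply hinj
        rw [hχ, hχ, ha', map_one, mul_one, Algebra.TensorProduct.tmul_mul_tmul, one_mul, one_mul]
      obtain ⟨b, rfl⟩ := FaithfullyFlat.mem_range j hl hr hff h1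
      exact ⟨b, b.2, rfl⟩
  · intro b hb hb'
    have h1 := FaithfullyFlat.injective j hl hr hff
    have h2 : (⟨b, hb⟩ : coinvariants ρ) = 0 := h1 (by rw [map_zero]; exact hb')
    exact congrArg Subtype.val h2

/-- The quotient `A' = A / A g(K ∩ ker ε)` is a principal comodule algebra. -/
theorem IsPrincipal.of_quotient (hJ : IsLeftPrincipal (quotientCoaction k J))
    (hρ : IsPrincipal ρ) {g : coinvH k J →ₐ[k] A}
    (hg : ∀ x, ρ (g x) = TensorProduct.map g.toLinearMap LinearMap.id (coinvCoaction k J x))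
    (hπ : Function.Surjective π)
    (hπg : ∀ x : coinvH k J, Coalgebra.counit (R := k) (x : H) = 0 → π (g x) = 0)
    (hker : ∀ a, π a = 0 →
      a ∈ Ideal.span {a | ∃ x : coinvH k J, Coalgebra.counit (R := k) (x : H) = 0 ∧ g x = a})
    (hρ' : ∀ a, ρ' (π a) = Algebra.TensorProduct.map π (Ideal.Quotient.mkₐ k J) (ρ a)) :
    IsPrincipal ρ' := by
  let p : coinvariants ρ →+* coinvariants ρ' :=
    ((π.comp (coinvariants ρ).val).codRestrict (coinvariants ρ')
      fun b => map_coinvariants_le hρ' b.2 : coinvariants ρ →ₐ[k] coinvariants ρ')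
  have hp : Function.Surjective p := by
    rintro ⟨a, ha⟩
    rw [← (coinvariants_of_quotient hJ hρ hg hπ hπg hker hρ').1] at ha
    obtain ⟨b, hb, rfl⟩ := ha
    exact ⟨⟨b, hb⟩, rfl⟩
  refine ⟨hρ.coaction.of_surjective hπ hρ', ?_, ?_⟩
  -- The same two results now apply with the actual coinvariants of `A'`, onto which `p` is
  -- surjective.
  · exact galois_of_quotient hJ.galois.1 hρ.galois hg hπ hπg hρ' p
      (fun b a => (map_mul π (b : A) a).symm) (fun b a => (map_mul π a (b : A)).symm) _
      (canonicalMap_tmul ρ')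
  · exact FaithfullyFlat.of_quotient (p := p) hρ.coaction hρ.flat hJ.flat hg hπ hπg hker hp
      fun b a => (map_mul π (b : A) a).symm

end Reduction

/-! ### Tensor products and finite limits over a field -/

section FiniteLimits

variable {k : Type*} [Field k] {ι κ : Type*} {M : ι → Type*} [∀ i, AddCommGroup (M i)]
  [∀ i, Module k (M i)] (P : Submodule k (∀ i, M i)) (X : Type*) [AddCommGroup X] [Module k X]

/-- The components of a subspace of a product. -/
def component (i : ι) : P →ₗ[k] M i := LinearMap.proj i ∘ₗ P.subtype

/-- Over a field `P ⊗ X` embeds in the tensor product of the full product with `X`, and finite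
products commute with `- ⊗ X`. -/
theorem rTensor_component_injective [Finite ι] {t t' : P ⊗[k] X}
    (h : ∀ i, (component P i).rTensor X t = (component P i).rTensor X t') : t = t' := by
  classical
  cases nonempty_fintype ι
  apply Module.Flat.rTensor_preserves_injective_linearMap (M := X) P.subtype P.injective_subtype
  apply (TensorProduct.piLeft k X M).injective
  have hpi : ∀ (u : (∀ i, M i) ⊗[k] X) i, TensorProduct.piLeft k X M u i =
      (LinearMap.proj i : (∀ i, M i) →ₗ[k] M i).rTensor X u := by
    intro u i
    induction u with
    | zero => simp
    | tmul s x => simp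
    | add s t hs ht => simp only [map_add, Pi.add_apply, hs, ht]
  funext i
  rw [hpi, hpi, ← LinearMap.comp_apply, ← LinearMap.rTensor_comp]
  rw [← LinearMap.comp_apply (LinearMap.rTensor X (LinearMap.proj i)), ← LinearMap.rTensor_comp]
  exact h i

variable {P} in
/-- Tensor products over a field commute with finite limits. -/
theorem exists_rTensor_component [Finite ι] [Finite κ] {a b : κ → ι}
    (r : ∀ j, M (a j) →ₗ[k] M (b j)) (hP : ∀ s, s ∈ P ↔ ∀ j, r j (s (a j)) = s (b j))
    (t : ∀ i, M i ⊗[k] X) (ht : ∀ j, (r j).rTensor X (t (a j)) = t (b j)) :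
    ∃ u : P ⊗[k] X, ∀ i, (component P i).rTensor X u = t i := by
  classical
  cases nonempty_fintype ι
  cases nonempty_fintype κ
  -- The subspace `P` is the kernel of `δ`, and flatness keeps it the kernel after `- ⊗ X`.
  let δ : (∀ i, M i) →ₗ[k] ∀ j, M (b j) :=
    LinearMap.pi fun j => r j ∘ₗ LinearMap.proj (a j) - LinearMap.proj (b j)
  have hex : Function.Exact P.subtype δ := by
    intro s
    have : δ s = 0 ↔ s ∈ P := by
      rw [hP, funext_iff]
      exact forall_congr' fun j => sub_eq_zero
    rw [this]
    simp
  have hpi : ∀ (u : (∀ i, M i) ⊗[k] X) i, TensorProduct.piLeft k X M u i =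
      (LinearMap.proj i : (∀ i, M i) →ₗ[k] M i).rTensor X u := by
    intro u i
    induction u with
    | zero => simp
    | tmul s x => simp
    | add s t hs ht => simp only [map_add, Pi.add_apply, hs, ht]
  have hδ : ∀ (u : (∀ i, M i) ⊗[k] X) j,
      TensorProduct.piLeft k X (fun j => M (b j)) (δ.rTensor X u) j =
        (r j).rTensor X (TensorProduct.piLeft k X M u (a j)) -
          TensorProduct.piLeft k X M u (b j) := by
    intro u j
    induction u with
    | zero => simp
    | tmul s x => simp [δ, TensorProduct.sub_tmul]
    | add s t hs ht => simp only [map_add, Pi.add_apply, hs, ht]; abel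
  obtain ⟨u, hu⟩ := (TensorProduct.piLeft k X M).surjective t
  obtain ⟨v, hv⟩ := (Module.Flat.rTensor_exact X hex u).1 (by
    apply (TensorProduct.piLeft k X (fun j => M (b j))).injective
    funext j
    rw [hδ, hu, ht, sub_self, map_zero]
    rfl)
  refine ⟨v, fun i => ?_⟩
  rw [component, LinearMap.rTensor_comp, LinearMap.comp_apply, hv, ← hpi, hu]

end FiniteLimits

/-! ### Minimal neighbourhoods in a topology generated by finitely many open sets -/

section MinimalOpens

variable {M : TopCat.{u}}

/-- The smallest open neighbourhood of some point. -/
def IsMinimalNhd (W : Opens M) : Prop := ∃ x ∈ W, ∀ V : Opens M, x ∈ V → W ≤ V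

/-- The distinguished point lies in one member of the family, which then contains all of `W`. This
is why no refinement is needed to glue over minimal neighbourhoods. -/
theorem IsMinimalNhd.le_of_le_iSup {W : Opens M} (hW : IsMinimalNhd W) {I : Type*}
    {U : I → Opens M} (h : W ≤ iSup U) : ∃ i, W ≤ U i := by
  obtain ⟨x, hx, hmin⟩ := hW
  obtain ⟨i, hi⟩ := Opens.mem_iSup.1 (h hx)
  exact ⟨i, hmin _ hi⟩

variable {I : Type*} {U : I → Opens M}

theorem generated_nhd_le
    (hM : M.str = TopologicalSpace.generateFrom (Set.range fun i => (U i : Set M)))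
    (x : M) (V : Opens M) (hx : x ∈ V) : ⨅ i : {i // x ∈ U i}, U i ≤ V := by
  have hV : TopologicalSpace.GenerateOpen (Set.range fun i => (U i : Set M)) (V : Set M) :=
    (congrArg (fun t : TopologicalSpace M => @IsOpen M t V) hM).mp V.isOpen
  suffices ∀ s, TopologicalSpace.GenerateOpen (Set.range fun i => (U i : Set M)) s → x ∈ s →
      ((⨅ i : {i // x ∈ U i}, U i : Opens M) : Set M) ⊆ s from this V hV hx
  intro s hs
  induction hs with
  | basic s hs =>
    obtain ⟨i, rfl⟩ := hs
    intro hx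
    exact iInf_le (fun i : {i // x ∈ U i} => U i) ⟨i, hx⟩
  | univ => exact fun _ => Set.subset_univ _
  | inter s t _ _ hs ht => exact fun hx => Set.subset_inter (hs hx.1) (ht hx.2)
  | sUnion S _ hS =>
    rintro ⟨s, hs, hx⟩
    exact (hS s hs hx).trans (Set.subset_sUnion_of_mem hs)

variable [Finite I]

/-- An infimum of open sets is an interior in general; finiteness makes it the plain intersection,
which contains `x`. -/
theorem mem_generated_nhd (x : M) : x ∈ ⨅ i : {i // x ∈ U i}, U i := by
  rw [← SetLike.mem_coe, Opens.coe_iInf, Set.mem_iInter]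
  exact fun i => i.2

theorem exists_isMinimalNhd
    (hM : M.str = TopologicalSpace.generateFrom (Set.range fun i => (U i : Set M)))
    {x : M} {V : Opens M} (hx : x ∈ V) : ∃ W, IsMinimalNhd W ∧ x ∈ W ∧ W ≤ V :=
  ⟨_, ⟨x, mem_generated_nhd x, generated_nhd_le hM x⟩, mem_generated_nhd x,
    generated_nhd_le hM x V hx⟩

/-- A minimal neighbourhood of `x` is determined by the set of indices `i` with `x ∈ U i`. -/
theorem finite_isMinimalNhd
    (hM : M.str = TopologicalSpace.generateFrom (Set.range fun i => (U i : Set M))) :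
    {W : Opens M | IsMinimalNhd W}.Finite := by
  refine (Set.finite_range fun T : Set I => ⨅ i : T, U i).subset ?_
  rintro W ⟨x, hx, hW⟩
  refine ⟨{i | x ∈ U i}, le_antisymm ?_ (hW _ (mem_generated_nhd x))⟩
  exact generated_nhd_le hM x W hx

end MinimalOpens

/-! ### The sheaf of compatible families over minimal neighbourhoods -/

section MinimalSections

variable {k : Type u} [Field k] {M : TopCat.{u}}

/-- The open sets contained in `V` that are smallest neighbourhoods of one of their points. -/
abbrev MinimalNhds (V : Opens M) : Type u := {W : Opens M // IsMinimalNhd W ∧ W ≤ V}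

/-- Restriction of sections of a presheaf of algebras. -/
def presheafRes (Q : TopCat.Presheaf (AlgCat.{u} k) M) {V U : Opens M} (h : V ≤ U) :
    Q.obj (op U) →ₐ[k] Q.obj (op V) :=
  (Q.map (homOfLE h).op).hom

theorem presheafRes_trans (Q : TopCat.Presheaf (AlgCat.{u} k) M) {W V U : Opens M} (h : W ≤ V)
    (h' : V ≤ U) (a : Q.obj (op U)) :
    presheafRes Q h (presheafRes Q h' a) = presheafRes Q (h.trans h') a := by
  have : Q.map (homOfLE (h.trans h')).op = Q.map (homOfLE h').op ≫ Q.map (homOfLE h).op := by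
    rw [← Q.map_comp]
    rfl
  rw [presheafRes, presheafRes, presheafRes, this]
  rfl

theorem presheafRes_refl (Q : TopCat.Presheaf (AlgCat.{u} k) M) {U : Opens M} (h : U ≤ U)
    (a : Q.obj (op U)) : presheafRes Q h a = a := by
  have : Q.map (homOfLE h).op = 𝟙 _ := Q.map_id _
  rw [presheafRes, this]
  rfl

variable (Q : TopCat.Presheaf (AlgCat.{u} k) M)

/-- Compatible families of sections over the minimal open subsets of `V`. -/
def minimalSections (V : Opens M) : Subalgebra k (∀ W : MinimalNhds V, Q.obj (op W.1)) where
  carrier := {s | ∀ (W W' : MinimalNhds V) (h : W'.1 ≤ W.1), presheafRes Q h (s W) = s W'}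
  mul_mem' hs ht W W' h := by
    rw [Pi.mul_apply, map_mul, hs W W' h, ht W W' h]
    rfl
  add_mem' hs ht W W' h := by
    rw [Pi.add_apply, map_add, hs W W' h, ht W W' h]
    rfl
  algebraMap_mem' r W W' h := by
    rw [Pi.algebraMap_apply, AlgHom.commutes]
    rfl

theorem minimalSections_compatible {V : Opens M} (s : minimalSections Q V) (W W' : MinimalNhds V)
    (h : W'.1 ≤ W.1) : presheafRes Q h (s.1 W) = s.1 W' :=
  s.2 W W' h

/-- The component of a compatible family at a minimal open set. -/
def minimalSections.eval {V : Opens M} (W : MinimalNhds V) :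
    minimalSections Q V →ₐ[k] Q.obj (op W.1) :=
  (Pi.evalAlgHom k (fun W : MinimalNhds V => Q.obj (op W.1)) W).comp (minimalSections Q V).val

/-- Restriction of compatible families. -/
def minimalSections.restrict {V V' : Opens M} (h : V' ≤ V) :
    minimalSections Q V →ₐ[k] minimalSections Q V' :=
  AlgHom.codRestrict
    (AlgHom.pi fun W : MinimalNhds V' =>
      minimalSections.eval Q (⟨W.1, W.2.1, W.2.2.trans h⟩ : MinimalNhds V))
    (minimalSections Q V') fun s W W' h' =>
      s.2 ⟨W.1, W.2.1, W.2.2.trans h⟩ ⟨W'.1, W'.2.1, W'.2.2.trans h⟩ h'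

variable {Q} in
theorem minimalSections.ext {V : Opens M} {s t : minimalSections Q V}
    (h : ∀ W, eval Q W s = eval Q W t) : s = t :=
  Subtype.ext (funext h)

/-- The presheaf of compatible families of sections over minimal open sets. -/
def minimalPresheaf : TopCat.Presheaf (AlgCat.{u} k) M where
  obj V := AlgCat.of k (minimalSections Q V.unop)
  map i := AlgCat.ofHom (minimalSections.restrict Q i.unop.le)
  map_id _ := rfl
  map_comp _ _ := rfl

theorem minimalPresheaf_isSheaf : (minimalPresheaf Q).IsSheaf := by
  rw [TopCat.Presheaf.isSheaf_iff_isSheafUniqueGluing]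
  intro ι U sf hsf
  change ∀ i, minimalSections Q (U i) at sf
  have hloc : ∀ W : MinimalNhds (iSup U), ∃ i, W.1 ≤ U i := fun W => W.2.1.le_of_le_iSup W.2.2
  choose i hi using hloc
  -- The value at `W` does not depend on the chosen member containing `W`, since the sections agree
  -- on the overlap.
  have hval : ∀ (W : Opens M) (hW : IsMinimalNhd W) (j l : ι) (hj : W ≤ U j) (hl : W ≤ U l),
      (sf j).1 ⟨W, hW, hj⟩ = (sf l).1 ⟨W, hW, hl⟩ := by
    intro W hW j l hj hl
    exact congrArg (fun s : minimalSections Q (U j ⊓ U l) => s.1 ⟨W, hW, le_inf hj hl⟩) (hsf j l)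
  let s : minimalSections Q (iSup U) := ⟨fun W => (sf (i W)).1 ⟨W.1, W.2.1, hi W⟩, by
    intro W W' h
    change presheafRes Q h ((sf (i W)).1 ⟨W.1, W.2.1, hi W⟩) = (sf (i W')).1 ⟨W'.1, W'.2.1, hi W'⟩
    rw [hval W'.1 W'.2.1 (i W') (i W) (hi W') (h.trans (hi W))]
    exact (sf (i W)).2 ⟨W.1, W.2.1, hi W⟩ ⟨W'.1, W'.2.1, h.trans (hi W)⟩ h⟩
  refine ⟨s, ?_, ?_⟩
  · intro j
    apply minimalSections.ext
    intro W
    exact hval W.1 W.2.1 _ j (hi ⟨W.1, W.2.1, W.2.2.trans (le_iSup U j)⟩) W.2.2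
  · intro t ht
    apply minimalSections.ext
    intro W
    exact congrArg (fun s : minimalSections Q (U (i W)) => s.1 ⟨W.1, W.2.1, hi W⟩) (ht (i W))

/-- The sheaf of compatible families of sections over minimal open sets. -/
def minimalSheaf : TopCat.Sheaf (AlgCat.{u} k) M := ⟨minimalPresheaf Q, minimalPresheaf_isSheaf Q⟩

/-- The family of restrictions of a section to minimal open sets. -/
def toMinimalSections (V : Opens M) : Q.obj (op V) →ₐ[k] minimalSections Q V :=
  AlgHom.codRestrict (AlgHom.pi fun W : MinimalNhds V => presheafRes Q W.2.2)
    (minimalSections Q V) fun a _ _ h => presheafRes_trans Q h _ a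

/-- The canonical morphism from a presheaf to the sheaf of compatible families of sections over
minimal open sets. -/
def toMinimalPresheaf : Q ⟶ minimalPresheaf Q where
  app V := AlgCat.ofHom (toMinimalSections Q V.unop)
  naturality {V V'} i := by
    apply AlgCat.hom_ext
    apply AlgHom.ext
    intro a
    apply minimalSections.ext
    intro W
    exact presheafRes_trans Q W.2.2 i.unop.le a

end MinimalSections

/-! ### The coaction on compatible families -/

section Coaction

variable {k : Type u} [Field k] {M : TopCat.{u}} (Q : TopCat.Presheaf (AlgCat.{u} k) M)
  {H : Type u} [Ring H] [HopfAlgebra k H]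

/-- Compatible families form a finite limit, so tensors are determined by their components. Each
identity for the coaction on families is thereby reduced to a minimal neighbourhood. -/
theorem minimalSections.tensor_ext (hfin : {W : Opens M | IsMinimalNhd W}.Finite) {V : Opens M}
    {X : Type*} [AddCommGroup X] [Module k X] {t t' : minimalSections Q V ⊗[k] X}
    (h : ∀ W, (eval Q W).toLinearMap.rTensor X t = (eval Q W).toLinearMap.rTensor X t') :
    t = t' := by
  have : Finite (MinimalNhds V) := (hfin.subset fun W hW => hW.1).to_subtype
  exact rTensor_component_injective (Subalgebra.toSubmodule (minimalSections Q V)) X h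

theorem minimalSections.exists_tensor (hfin : {W : Opens M | IsMinimalNhd W}.Finite) {V : Opens M}
    {X : Type*} [AddCommGroup X] [Module k X] (t : ∀ W : MinimalNhds V, Q.obj (op W.1) ⊗[k] X)
    (ht : ∀ (W W' : MinimalNhds V) (h : W'.1 ≤ W.1),
      (presheafRes Q h).toLinearMap.rTensor X (t W) = t W') :
    ∃ u : minimalSections Q V ⊗[k] X, ∀ W, (eval Q W).toLinearMap.rTensor X u = t W := by
  have : Finite (MinimalNhds V) := (hfin.subset fun W hW => hW.1).to_subtype
  exact exists_rTensor_component (P := Subalgebra.toSubmodule (minimalSections Q V)) X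
    (κ := {p : MinimalNhds V × MinimalNhds V // p.2.1 ≤ p.1.1}) (a := fun p => p.1.1)
    (b := fun p => p.1.2) (fun p => (presheafRes Q p.2).toLinearMap)
    (fun s => ⟨fun hs p => hs p.1.1 p.1.2 p.2, fun hs W W' h => hs ⟨(W, W'), h⟩⟩) t
    fun p => ht p.1.1 p.1.2 p.2

end Coaction

section Coaction

variable {k H : Type u} [Field k] [Ring H] [HopfAlgebra k H]

theorem coassoc_of_intertwines {A A' : Type u} [Ring A] [Algebra k A] [Ring A'] [Algebra k A']
    {ρ : A →ₐ[k] A ⊗[k] H} {ρ' : A' →ₐ[k] A' ⊗[k] H} {e : A →ₐ[k] A'}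
    (h : ∀ a, e.toLinearMap.rTensor H (ρ a) = ρ' (e a)) (a : A) :
    e.toLinearMap.rTensor (H ⊗[k] H)
      (TensorProduct.assoc k A H H (TensorProduct.map ρ.toLinearMap LinearMap.id (ρ a))) =
    TensorProduct.assoc k A' H H (TensorProduct.map ρ'.toLinearMap LinearMap.id (ρ' (e a))) := by
  have h1 : ∀ t : A ⊗[k] H, e.toLinearMap.rTensor (H ⊗[k] H)
      (TensorProduct.assoc k A H H (TensorProduct.map ρ.toLinearMap LinearMap.id t)) =
      TensorProduct.assoc k A' H H (TensorProduct.map ρ'.toLinearMap LinearMap.id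
        (e.toLinearMap.rTensor H t)) := by
    intro t
    induction t with
    | zero => simp
    | tmul b x =>
      simp only [TensorProduct.map_tmul, LinearMap.rTensor_tmul, AlgHom.toLinearMap_apply, ← h,
        LinearMap.id_apply]
      generalize ρ b = u
      induction u with
      | zero => simp
      | tmul c d => simp
      | add s t hs ht => simp only [map_add, TensorProduct.add_tmul, hs, ht]
    | add s t hs ht => simp only [map_add, hs, ht]
  rw [h1, h]

theorem counit_of_intertwines {A A' : Type u} [Ring A] [Algebra k A] [Ring A'] [Algebra k A']
    {ρ : A →ₐ[k] A ⊗[k] H} {ρ' : A' →ₐ[k] A' ⊗[k] H} {e : A →ₐ[k] A'}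
    (h : ∀ a, e.toLinearMap.rTensor H (ρ a) = ρ' (e a)) (a : A) :
    e.toLinearMap.rTensor k (TensorProduct.map LinearMap.id Coalgebra.counit (ρ a)) =
    TensorProduct.map LinearMap.id Coalgebra.counit (ρ' (e a)) := by
  rw [← h]
  generalize ρ a = u
  induction u with
  | zero => simp
  | tmul c d => simp
  | add s t hs ht => simp only [map_add, hs, ht]

variable {M : TopCat.{u}} (Q : TopCat.Presheaf (AlgCat.{u} k) M)
  (ρ : ∀ W : Opens M, Q.obj (op W) →ₐ[k] Q.obj (op W) ⊗[k] H)

theorem minimalSections.exists_coaction (hfin : {W : Opens M | IsMinimalNhd W}.Finite)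
    (hres : ∀ {V U : Opens M} (h : V ≤ U) (a : Q.obj (op U)),
      ρ V (presheafRes Q h a) = (presheafRes Q h).toLinearMap.rTensor H (ρ U a))
    (V : Opens M) : ∃ δ : minimalSections Q V →ₐ[k] minimalSections Q V ⊗[k] H,
      ∀ W s, (eval Q W).toLinearMap.rTensor H (δ s) = ρ W.1 (eval Q W s) := by
  -- The coactions of the components form a compatible family of tensors, which comes from one
  -- tensor. Its uniqueness makes the resulting map linear and multiplicative.
  have hex : ∀ s : minimalSections Q V, ∃ u : minimalSections Q V ⊗[k] H,
      ∀ W, (eval Q W).toLinearMap.rTensor H u = ρ W.1 (eval Q W s) := fun s =>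
    exists_tensor Q hfin (fun W => ρ W.1 (eval Q W s)) fun W W' h => by
      rw [← hres]
      exact congrArg (ρ W'.1) (s.2 W W' h)
  have hmul : ∀ (W : MinimalNhds V) (t t' : minimalSections Q V ⊗[k] H),
      (eval Q W).toLinearMap.rTensor H (t * t') =
        (eval Q W).toLinearMap.rTensor H t * (eval Q W).toLinearMap.rTensor H t' := fun W =>
    map_mul (Algebra.TensorProduct.map (eval Q W) (AlgHom.id k H))
  have hone : ∀ (W : MinimalNhds V), (eval Q W).toLinearMap.rTensor H 1 = 1 := fun W =>
    map_one (Algebra.TensorProduct.map (eval Q W) (AlgHom.id k H))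
  choose δ hδ using hex
  let δ' : minimalSections Q V →ₗ[k] minimalSections Q V ⊗[k] H :=
    { toFun := δ
      map_add' := fun s t => tensor_ext Q hfin fun W => by
        rw [map_add, hδ, hδ, hδ, map_add, map_add]
      map_smul' := fun c s => tensor_ext Q hfin fun W => by
        rw [RingHom.id_apply, map_smul, hδ, hδ, map_smul, map_smul] }
  refine ⟨AlgHom.ofLinearMap δ' (tensor_ext Q hfin fun W => ?_)
    fun s t => tensor_ext Q hfin fun W => ?_, fun W s => hδ s W⟩
  · change LinearMap.rTensor H _ (δ 1) = _
    rw [hδ, hone, map_one, map_one]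
  · change LinearMap.rTensor H _ (δ (s * t)) = LinearMap.rTensor H _ (δ s * δ t)
    rw [hδ, hmul, hδ, hδ, map_mul, map_mul]

theorem minimalSections.isRightCoaction (hfin : {W : Opens M | IsMinimalNhd W}.Finite)
    (hρ : ∀ W, IsRightCoaction (ρ W)) {V : Opens M}
    {δ : minimalSections Q V →ₐ[k] minimalSections Q V ⊗[k] H}
    (hδ : ∀ W s, (eval Q W).toLinearMap.rTensor H (δ s) = ρ W.1 (eval Q W s)) :
    IsRightCoaction δ := by
  constructor
  · intro s
    refine tensor_ext Q hfin fun W => ?_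
    rw [coassoc_of_intertwines (hδ W), (hρ W.1).coassoc, ← hδ W]
    generalize δ s = u
    induction u with
    | zero => simp
    | tmul c d => rfl
    | add s t hs ht => simp only [map_add, hs, ht]
  · intro s
    refine tensor_ext Q hfin fun W => ?_
    rw [counit_of_intertwines (hδ W), (hρ W.1).counit]
    rfl

theorem minimalSections.coaction_restrict (hfin : {W : Opens M | IsMinimalNhd W}.Finite)
    {V V' : Opens M} (h : V ≤ V')
    {δ : minimalSections Q V →ₐ[k] minimalSections Q V ⊗[k] H}
    {δ' : minimalSections Q V' →ₐ[k] minimalSections Q V' ⊗[k] H}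
    (hδ' : ∀ W s, (eval Q W).toLinearMap.rTensor H (δ' s) = ρ W.1 (eval Q W s))
    (hδ : ∀ W s, (eval Q W).toLinearMap.rTensor H (δ s) = ρ W.1 (eval Q W s))
    (s : minimalSections Q V') :
    δ (restrict Q h s) =
      Algebra.TensorProduct.map (restrict Q h) (AlgHom.id k H) (δ' s) := by
  refine tensor_ext Q hfin fun W => ?_
  rw [hδ]
  refine (hδ' ⟨W.1, W.2.1, W.2.2.trans h⟩ s).symm.trans ?_
  generalize δ' s = u
  induction u with
  | zero => simp
  | tmul c d => rfl
  | add s t hs ht => simp only [map_add, hs, ht]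

/-- The sheaf of compatible families of sections over minimal open sets of a presheaf of comodule
algebras. -/
def minimalComoduleSheaf (hfin : {W : Opens M | IsMinimalNhd W}.Finite)
    (hρ : ∀ W, IsRightCoaction (ρ W))
    (hres : ∀ {V U : Opens M} (h : V ≤ U) (a : Q.obj (op U)),
      ρ V (presheafRes Q h a) = (presheafRes Q h).toLinearMap.rTensor H (ρ U a)) :
    ComoduleAlgebraSheaf k H M where
  sheaf := minimalSheaf Q
  coact V := (minimalSections.exists_coaction Q ρ hfin hres V).choose
  isCoaction V := minimalSections.isRightCoaction Q ρ hfin hρ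
    (minimalSections.exists_coaction Q ρ hfin hres V).choose_spec
  res_coact {V V'} h := minimalSections.coaction_restrict Q ρ hfin h
    (minimalSections.exists_coaction Q ρ hfin hres V').choose_spec
    (minimalSections.exists_coaction Q ρ hfin hres V).choose_spec

theorem eval_minimalComoduleSheaf_coact (hfin : {W : Opens M | IsMinimalNhd W}.Finite)
    (hρ : ∀ W, IsRightCoaction (ρ W))
    (hres : ∀ {V U : Opens M} (h : V ≤ U) (a : Q.obj (op U)),
      ρ V (presheafRes Q h a) = (presheafRes Q h).toLinearMap.rTensor H (ρ U a))
    {V : Opens M} (W : MinimalNhds V) (s : minimalSections Q V) :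
    (minimalSections.eval Q W).toLinearMap.rTensor H
      ((minimalComoduleSheaf Q ρ hfin hρ hres).coact V s) = ρ W.1 (minimalSections.eval Q W s) :=
  (minimalSections.exists_coaction Q ρ hfin hres V).choose_spec W s

end Coaction

/-! ### Quotients of a presheaf by generated ideals -/

section QuotientPresheaf

variable {k : Type u} [Field k] {M : TopCat.{u}} (P : TopCat.Presheaf (AlgCat.{u} k) M)
  {G : ∀ V : Opens M, Set (P.obj (op V))}

/-- The ideal generated by a set of sections. -/
abbrev sectionIdeal (G : ∀ V : Opens M, Set (P.obj (op V))) (V : Opens M) :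
    Ideal (P.obj (op V)) :=
  TwoSidedIdeal.asIdeal (TwoSidedIdeal.span (G V))

theorem map_mem_span {A B : Type*} [Ring A] [Ring B] (e : A →+* B) {s : Set A} {t : Set B}
    (h : ∀ a ∈ s, e a ∈ TwoSidedIdeal.span t) {a : A} (ha : a ∈ TwoSidedIdeal.span s) :
    e a ∈ TwoSidedIdeal.span t := by
  have : TwoSidedIdeal.span s ≤ (TwoSidedIdeal.span t).comap e :=
    TwoSidedIdeal.span_le.2 fun a ha => (TwoSidedIdeal.mem_comap e).2 (h a ha)
  exact (TwoSidedIdeal.mem_comap e).1 (this ha)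

theorem map_eq_zero_of_mem_span {A B : Type*} [Ring A] [Ring B] (e : A →+* B) {s : Set A}
    (h : ∀ a ∈ s, e a = 0) {a : A} (ha : a ∈ TwoSidedIdeal.span s) : e a = 0 := by
  have : TwoSidedIdeal.span s ≤ TwoSidedIdeal.ker e :=
    TwoSidedIdeal.span_le.2 fun a ha => (TwoSidedIdeal.mem_ker e).2 (h a ha)
  exact (TwoSidedIdeal.mem_ker e).1 (this ha)

variable (hG : ∀ {V U : Opens M} (h : V ≤ U), ∀ a ∈ G U, presheafRes P h a ∈ G V)

/-- Restriction of classes of sections. -/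
def quotientRes {V U : Opens M} (h : V ≤ U) :
    P.obj (op U) ⧸ sectionIdeal P G U →ₐ[k] P.obj (op V) ⧸ sectionIdeal P G V :=
  Ideal.Quotient.liftₐ _ ((Ideal.Quotient.mkₐ k (sectionIdeal P G V)).comp (presheafRes P h))
    fun _ ha => Ideal.Quotient.eq_zero_iff_mem.2 <| TwoSidedIdeal.mem_asIdeal.2 <|
      map_mem_span (presheafRes P h).toRingHom
        (fun b hb => TwoSidedIdeal.subset_span (hG h b hb)) (TwoSidedIdeal.mem_asIdeal.1 ha)

/-- The quotient of a presheaf of algebras by the ideals generated by sets of sections. -/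
def quotientPresheaf : TopCat.Presheaf (AlgCat.{u} k) M where
  obj V := AlgCat.of k (P.obj (op V.unop) ⧸ sectionIdeal P G V.unop)
  map i := AlgCat.ofHom (quotientRes P hG i.unop.le)
  map_id V := by
    apply AlgCat.hom_ext
    apply AlgHom.ext
    intro a
    obtain ⟨a, rfl⟩ := Ideal.Quotient.mkₐ_surjective k _ a
    exact congrArg (Ideal.Quotient.mkₐ k _) (presheafRes_refl P le_rfl a)
  map_comp i j := by
    apply AlgCat.hom_ext
    apply AlgHom.ext
    intro a
    obtain ⟨a, rfl⟩ := Ideal.Quotient.mkₐ_surjective k _ a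
    exact congrArg (Ideal.Quotient.mkₐ k _) (presheafRes_trans P j.unop.le i.unop.le a).symm

/-- The class of a section. -/
def toQuotient (V : Opens M) : P.obj (op V) →ₐ[k] (quotientPresheaf P hG).obj (op V) :=
  Ideal.Quotient.mkₐ k (sectionIdeal P G V)

theorem toQuotient_surjective (V : Opens M) : Function.Surjective (toQuotient P hG V) :=
  Ideal.Quotient.mkₐ_surjective k _

theorem toQuotient_eq_zero_iff {V : Opens M} (a : P.obj (op V)) :
    toQuotient P hG V a = 0 ↔ a ∈ TwoSidedIdeal.span (G V) :=
  Ideal.Quotient.eq_zero_iff_mem.trans TwoSidedIdeal.mem_asIdeal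

theorem presheafRes_toQuotient {V U : Opens M} (h : V ≤ U) (a : P.obj (op U)) :
    presheafRes (quotientPresheaf P hG) h (toQuotient P hG U a) =
      toQuotient P hG V (presheafRes P h a) := rfl

/-- The canonical morphism to the quotient presheaf. -/
def toQuotientPresheaf : P ⟶ quotientPresheaf P hG where
  app V := AlgCat.ofHom (toQuotient P hG V.unop)
  naturality _ _ _ := rfl

/-- The algebra map on the quotient induced by an algebra map vanishing on the generators. -/
def quotientLift {V : Opens M} {B : Type*} [Ring B] [Algebra k B] (e : P.obj (op V) →ₐ[k] B)
    (he : ∀ a ∈ G V, e a = 0) : (quotientPresheaf P hG).obj (op V) →ₐ[k] B :=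
  Ideal.Quotient.liftₐ (sectionIdeal P G V) e fun _ ha =>
    map_eq_zero_of_mem_span e.toRingHom he (TwoSidedIdeal.mem_asIdeal.1 ha)

end QuotientPresheaf

/-! ### The quotient sheaf of `H ⧸ J`-comodule algebras -/

section QuotientSheaf

variable {k H : Type u} [Field k] [Ring H] [HopfAlgebra k H]

/-- Applying `π` turns `ρ(g(x))` into `1 ⊗ x`, and `x` becomes `ε(x) = 0` in `H ⧸ J`. This is the
stability that lets the coaction pass to the quotient. -/
theorem map_mk_coaction_eq_zero {A B : Type u} [Ring A] [Algebra k A] [Ring B] [Algebra k B]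
    {J : Ideal H} [J.IsTwoSided] [J.IsHopfIdeal k] {ρ : A →ₐ[k] A ⊗[k] H}
    {g : coinvH k J →ₐ[k] A} {π : A →ₐ[k] B}
    (hg : ∀ x, ρ (g x) = TensorProduct.map g.toLinearMap LinearMap.id (coinvCoaction k J x))
    (hπ : ∀ x : coinvH k J, Coalgebra.counit (R := k) (x : H) = 0 → π (g x) = 0)
    {x : coinvH k J} (hx : Coalgebra.counit (R := k) (x : H) = 0) :
    Algebra.TensorProduct.map π (Ideal.Quotient.mkₐ k J) (ρ (g x)) = 0 := by
  have h : ∀ t : A ⊗[k] H, Algebra.TensorProduct.map π (Ideal.Quotient.mkₐ k J) t =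
      Algebra.TensorProduct.map (AlgHom.id k B) (Ideal.Quotient.mkₐ k J)
        (Algebra.TensorProduct.map π (AlgHom.id k H) t) := fun t => by
    induction t with
    | zero => simp
    | tmul a y => simp
    | add s t hs ht => simp only [map_add, hs, ht]
  rw [h, map_coaction_of_trivial hg hπ, Algebra.TensorProduct.map_tmul,
    mk_eq_counit_of_mem_coinvH x.2, hx, map_zero, TensorProduct.tmul_zero]

variable {M : TopCat.{u}} {I : Type*}

/-- The restrictions to `V` of the elements of the sets `S i` of sections over `U i ⊇ V`. -/
def localGenerators (F : TopCat.Sheaf (AlgCat.{u} k) M) (U : I → Opens M)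
    (S : ∀ i, Set (F.presheaf.obj (op (U i)))) (V : Opens M) : Set (F.presheaf.obj (op V)) :=
  {a | ∃ (i : I) (h : V ≤ U i), a ∈ res F h '' S i}

theorem res_mem_localGenerators (F : TopCat.Sheaf (AlgCat.{u} k) M) (U : I → Opens M)
    (S : ∀ i, Set (F.presheaf.obj (op (U i)))) {V W : Opens M} (h : W ≤ V) :
    ∀ a ∈ localGenerators F U S V, presheafRes F.presheaf h a ∈ localGenerators F U S W := by
  rintro _ ⟨i, hi, a, ha, rfl⟩
  exact ⟨i, h.trans hi, a, ha, (presheafRes_trans F.presheaf h hi a).symm⟩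

/-- An open set inside both `U i` and `U j` lies in their overlap, where the two sets of generators
agree. A single index therefore suffices. -/
theorem localGenerators_eq {F : TopCat.Sheaf (AlgCat.{u} k) M} {U : I → Opens M}
    {S : ∀ i, Set (F.presheaf.obj (op (U i)))}
    (hS : ∀ i j, ∀ a ∈ S i, ∃ b ∈ S j, res F (inf_le_left : U i ⊓ U j ≤ U i) a =
      res F (inf_le_right : U i ⊓ U j ≤ U j) b) {V : Opens M} {i : I} (h : V ≤ U i) :
    localGenerators F U S V = res F h '' S i := by
  refine Set.Subset.antisymm ?_ fun a ha => ⟨i, h, ha⟩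
  rintro _ ⟨j, hj, a, ha, rfl⟩
  obtain ⟨b, hb, hab⟩ := hS j i a ha
  refine ⟨b, hb, ?_⟩
  have h1 := congrArg (presheafRes F.presheaf (le_inf hj h)) hab
  exact (((presheafRes_trans F.presheaf _ _ a).symm.trans h1).trans
    (presheafRes_trans F.presheaf _ _ b)).symm

variable (J : Ideal H) [J.IsTwoSided]
  (F : ComoduleAlgebraSheaf k H M) (U : I → Opens M)
  (S : ∀ i, Set (F.sheaf.presheaf.obj (op (U i))))

/-- The quotient of a sheaf of comodule algebras by the ideals generated by the sets of sections
`S i`, as a presheaf. -/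
abbrev localQuotient : TopCat.Presheaf (AlgCat.{u} k) M :=
  quotientPresheaf F.sheaf.presheaf (res_mem_localGenerators F.sheaf U S)

/-- The class of a section in the quotient by the ideal generated by the sets `S i`. -/
abbrev toLocalQuotient (V : Opens M) :
    F.sheaf.presheaf.obj (op V) →ₐ[k] (localQuotient F U S).obj (op V) :=
  toQuotient F.sheaf.presheaf (res_mem_localGenerators F.sheaf U S) V

/-- The sets `S i` of sections generate ideals that are stable under the coaction of `H ⧸ J`. -/
def IsCoactionStable : Prop :=
  ∀ (i : I) {B : Type u} [Ring B] [Algebra k B] (π : F.sheaf.presheaf.obj (op (U i)) →ₐ[k] B),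
    (∀ a ∈ S i, π a = 0) → ∀ a ∈ S i,
      Algebra.TensorProduct.map π (Ideal.Quotient.mkₐ k J) (F.coact (U i) a) = 0

variable {J F U S}

theorem IsCoactionStable.map_eq_zero (hS : IsCoactionStable J F U S) {V : Opens M} :
    ∀ a ∈ localGenerators F.sheaf U S V,
      Algebra.TensorProduct.map (toLocalQuotient F U S V) (Ideal.Quotient.mkₐ k J)
        (F.coact V a) = 0 := by
  rintro _ ⟨i, h, a, ha, rfl⟩
  -- Stability is stated for arbitrary `π`, so it applies to restriction to `V` followed by the
  -- class map.
  have h1 := hS i ((toLocalQuotient F U S V).comp (res F.sheaf h)) (fun b hb =>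
    (toQuotient_eq_zero_iff _ (res_mem_localGenerators F.sheaf U S) _).2 (TwoSidedIdeal.subset_span ⟨i, h, b, hb, rfl⟩)) a ha
  rw [F.res_coact, ← h1]
  generalize F.coact (U i) a = t
  induction t with
  | zero => simp
  | tmul b y => simp
  | add s t hs ht => simp only [map_add, hs, ht]

/-- The coaction of `H ⧸ J` on the quotient. -/
def IsCoactionStable.coact (hS : IsCoactionStable J F U S) (V : Opens M) :
    (localQuotient F U S).obj (op V) →ₐ[k] (localQuotient F U S).obj (op V) ⊗[k] (H ⧸ J) :=
  quotientLift _ (res_mem_localGenerators F.sheaf U S) ((Algebra.TensorProduct.map (toLocalQuotient F U S V)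
    (Ideal.Quotient.mkₐ k J)).comp (F.coact V)) hS.map_eq_zero

theorem IsCoactionStable.coact_toLocalQuotient (hS : IsCoactionStable J F U S) {V : Opens M}
    (a : F.sheaf.presheaf.obj (op V)) :
    hS.coact V (toLocalQuotient F U S V a) =
      Algebra.TensorProduct.map (toLocalQuotient F U S V) (Ideal.Quotient.mkₐ k J)
        (F.coact V a) := rfl

theorem IsCoactionStable.coact_res (hS : IsCoactionStable J F U S) {V W : Opens M} (h : W ≤ V)
    (a : (localQuotient F U S).obj (op V)) :
    hS.coact W (presheafRes _ h a) =
      (presheafRes (localQuotient F U S) h).toLinearMap.rTensor (H ⧸ J) (hS.coact V a) := by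
  obtain ⟨a, rfl⟩ := toQuotient_surjective _ (res_mem_localGenerators F.sheaf U S) V a
  rw [presheafRes_toQuotient, hS.coact_toLocalQuotient, hS.coact_toLocalQuotient]
  have h1 : F.coact W (presheafRes F.sheaf.presheaf h a) = _ := F.res_coact h a
  rw [h1]
  generalize F.coact V a = t
  induction t with
  | zero => simp
  | tmul b y => rfl
  | add s t hs ht => simp only [map_add, hs, ht]

variable [J.IsHopfIdeal k]

theorem IsCoactionStable.isRightCoaction (hS : IsCoactionStable J F U S) (V : Opens M) :
    IsRightCoaction (hS.coact V) :=
  IsRightCoaction.of_surjective (F.isCoaction V) (toQuotient_surjective _ (res_mem_localGenerators F.sheaf U S) V)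
    hS.coact_toLocalQuotient

/-- The quotient sheaf of comodule algebras. -/
def IsCoactionStable.quotientSheaf (hS : IsCoactionStable J F U S)
    (hfin : {W : Opens M | IsMinimalNhd W}.Finite) : ComoduleAlgebraSheaf k (H ⧸ J) M :=
  minimalComoduleSheaf (localQuotient F U S) hS.coact hfin hS.isRightCoaction hS.coact_res

/-- The projection to the quotient sheaf. -/
def IsCoactionStable.proj (hS : IsCoactionStable J F U S)
    (hfin : {W : Opens M | IsMinimalNhd W}.Finite) : F.sheaf ⟶ (hS.quotientSheaf hfin).sheaf :=
  ⟨toQuotientPresheaf F.sheaf.presheaf (res_mem_localGenerators F.sheaf U S) ≫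
    toMinimalPresheaf (localQuotient F U S)⟩

variable (hS : IsCoactionStable J F U S) (hfin : {W : Opens M | IsMinimalNhd W}.Finite)

theorem IsCoactionStable.eval_proj {V : Opens M} (W : MinimalNhds V)
    (a : F.sheaf.presheaf.obj (op V)) :
    minimalSections.eval (localQuotient F U S) W (appHom (hS.proj hfin) V a) =
      toLocalQuotient F U S W.1 (res F.sheaf W.2.2 a) := rfl

theorem IsCoactionStable.proj_colinear (V : Opens M) (a : F.sheaf.presheaf.obj (op V)) :
    (hS.quotientSheaf hfin).coact V (appHom (hS.proj hfin) V a) =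
      Algebra.TensorProduct.map (appHom (hS.proj hfin) V) (Ideal.Quotient.mkₐ k J)
        (F.coact V a) := by
  refine minimalSections.tensor_ext _ hfin fun W => ?_
  refine (eval_minimalComoduleSheaf_coact _ _ hfin _ _ W _).trans ?_
  refine (congrArg (hS.coact W.1) (hS.eval_proj hfin W a)).trans ?_
  rw [hS.coact_toLocalQuotient, F.res_coact]
  generalize F.coact V a = t
  induction t with
  | zero =>
    simp only [map_zero]
    exact (map_zero (LinearMap.rTensor (H ⧸ J) _)).symm
  | tmul b y => rfl
  | add s t hs ht =>
    simp only [map_add, hs, ht]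
    exact (map_add (LinearMap.rTensor (H ⧸ J) _) _ _).symm

theorem IsCoactionStable.proj_eq_zero_iff {V : Opens M} (a : F.sheaf.presheaf.obj (op V)) :
    appHom (hS.proj hfin) V a = 0 ↔
      ∀ W : MinimalNhds V, res F.sheaf W.2.2 a ∈
        TwoSidedIdeal.span (localGenerators F.sheaf U S W.1) := by
  refine ⟨fun h W => ?_, fun h => minimalSections.ext fun W => ?_⟩
  · rw [← toQuotient_eq_zero_iff _ (res_mem_localGenerators F.sheaf U S)]
    exact (hS.eval_proj hfin W a).symm.trans
      ((congrArg (minimalSections.eval (localQuotient F U S) W) h).trans (map_zero _))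
  · refine (hS.eval_proj hfin W a).trans (Eq.trans ?_ (map_zero _).symm)
    exact (toQuotient_eq_zero_iff _ (res_mem_localGenerators F.sheaf U S) _).2 (h W)

/-- When `V` is minimal it is the largest index of its own families, so a family is determined by
its value at `V`, and that value lifts. -/
theorem IsCoactionStable.proj_surjective_of_isMinimalNhd {V : Opens M} (hV : IsMinimalNhd V) :
    Function.Surjective (appHom (hS.proj hfin) V) := by
  intro s
  obtain ⟨a, ha⟩ := toQuotient_surjective _ (res_mem_localGenerators F.sheaf U S) V
    (minimalSections.eval (localQuotient F U S) ⟨V, hV, le_rfl⟩ s)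
  refine ⟨a, minimalSections.ext fun W => ?_⟩
  have h1 := minimalSections_compatible (localQuotient F U S) s ⟨V, hV, le_rfl⟩ W W.2.2
  refine (hS.eval_proj hfin W a).trans (Eq.trans ?_ h1)
  exact congrArg (presheafRes (localQuotient F U S) W.2.2) ha

theorem IsCoactionStable.proj_isLocallySurjective
    (hmin : ∀ (V : Opens M), ∀ x ∈ V, ∃ W, IsMinimalNhd W ∧ x ∈ W ∧ W ≤ V) :
    TopCat.Presheaf.IsLocallySurjective (hS.proj hfin).hom := by
  rw [TopCat.Presheaf.isLocallySurjective_iff]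
  intro V t x hx
  obtain ⟨W, hW, hxW, hWV⟩ := hmin V x hx
  obtain ⟨a, ha⟩ := hS.proj_surjective_of_isMinimalNhd hfin hW
    (res (hS.quotientSheaf hfin).sheaf hWV t)
  exact ⟨W, hWV, ⟨a, ha⟩, hxW⟩

theorem IsCoactionStable.ker_proj (hcov : iSup U = ⊤)
    (hmin : ∀ (V : Opens M), ∀ x ∈ V, ∃ W, IsMinimalNhd W ∧ x ∈ W ∧ W ≤ V)
    (hglue : ∀ i j, ∀ a ∈ S i, ∃ b ∈ S j, res F.sheaf (inf_le_left : U i ⊓ U j ≤ U i) a =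
      res F.sheaf (inf_le_right : U i ⊓ U j ≤ U j) b) (V : Opens M) :
    {a | appHom (hS.proj hfin) V a = 0} = locallyGeneratedIdeal F.sheaf U S V := by
  ext a
  refine (hS.proj_eq_zero_iff hfin a).trans ⟨fun h x hx => ?_, fun h W => ?_⟩
  · obtain ⟨W, hW, hxW, hWV⟩ := hmin V x hx
    obtain ⟨i, hi⟩ := hW.le_of_le_iSup (U := U) (hcov ▸ le_top)
    refine ⟨i, W, hWV, hi, hxW, ?_⟩
    rw [← localGenerators_eq hglue hi]
    exact h ⟨W, hW, hWV⟩
  -- Local membership is used at the point whose smallest neighbourhood is `W`: the witnessing open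
  -- set contains `W`, so membership restricts to `W`.
  · obtain ⟨x, hxW, hW⟩ := W.2.1
    obtain ⟨i, W', hWV, hi, hxW', ha⟩ := h x (W.2.2 hxW)
    have hle := hW W' hxW'
    have h1 := map_mem_span (presheafRes F.sheaf.presheaf hle).toRingHom
      (t := localGenerators F.sheaf U S W.1) (fun b hb => TwoSidedIdeal.subset_span <|
        res_mem_localGenerators F.sheaf U S hle b ⟨i, hi, hb⟩) ha
    have h2 := presheafRes_trans F.sheaf.presheaf hle hWV a
    exact h2 ▸ h1

theorem IsCoactionStable.proj_eq_zero_iff_of_isMinimalNhd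
    (hglue : ∀ i j, ∀ a ∈ S i, ∃ b ∈ S j, res F.sheaf (inf_le_left : U i ⊓ U j ≤ U i) a =
      res F.sheaf (inf_le_right : U i ⊓ U j ≤ U j) b) {i : I} (hi : IsMinimalNhd (U i))
    (a : F.sheaf.presheaf.obj (op (U i))) :
    appHom (hS.proj hfin) (U i) a = 0 ↔ a ∈ TwoSidedIdeal.span (S i) := by
  have h : localGenerators F.sheaf U S (U i) = S i := by
    rw [localGenerators_eq hglue le_rfl]
    exact (Set.image_congr fun a _ => presheafRes_refl F.sheaf.presheaf le_rfl a).trans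
      (Set.image_id _)
  rw [hS.proj_eq_zero_iff]
  refine ⟨fun h1 => ?_, fun h1 W => ?_⟩
  · have h2 := h1 ⟨U i, hi, le_rfl⟩
    rw [h] at h2
    exact presheafRes_refl F.sheaf.presheaf le_rfl a ▸ h2
  · refine map_mem_span (presheafRes F.sheaf.presheaf W.2.2).toRingHom (fun b hb => ?_) h1
    exact TwoSidedIdeal.subset_span ⟨i, W.2.2, b, hb, rfl⟩

end QuotientSheaf

/-! ### Members of the covering: empty or minimal -/

section MinimalCover

variable {k : Type u} [Field k] {M : TopCat.{u}}

/-- The empty family covers the empty set, so any two sections agree there. -/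
theorem subsingleton_of_eq_bot (F : TopCat.Sheaf (AlgCat.{u} k) M) {V : Opens M} (hV : V = ⊥) :
    Subsingleton (F.presheaf.obj (op V)) := by
  refine ⟨fun a b => ?_⟩
  refine F.eq_of_locally_eq' (fun i : PEmpty.{u + 1} => i.elim) V (fun i => i.elim) ?_ a b fun i => i.elim
  rw [hV]
  exact bot_le

/-- Minimality among the members of the covering extends to all open sets because the covering
generates the topology. -/
theorem isMinimalNhd_of_generates {I : Type*} {U : I → Opens M}
    (hM : M.str = TopologicalSpace.generateFrom (Set.range fun i => (U i : Set M))) {i : I}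
    (hi : ∃ x ∈ U i, ∀ j, x ∈ U j → U i ≤ U j) : IsMinimalNhd (U i) := by
  obtain ⟨x, hx, h⟩ := hi
  refine ⟨x, hx, fun V hV => ?_⟩
  have h1 : U i ≤ ⨅ j : {j // x ∈ U j}, U j := le_iInf fun j => h j.1 j.2
  have h2 := generated_nhd_le hM x V hV
  exact h1.trans h2

end MinimalCover

end

end QuantumBundle

/-! ### Assembly of the reduction -/

theorem mainTheorem1 {k H : Type u} [Field k] [Ring H] [HopfAlgebra k H]
    (hS : Function.Bijective (HopfAlgebra.antipode k (A := H)))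
    (J : Ideal H) [J.IsTwoSided] [J.IsHopfIdeal k]
    (hJ : QuantumBundle.IsLeftPrincipal (QuantumBundle.quotientCoaction k J))
    (M : TopCat.{u}) (O : TopCat.Sheaf (AlgCat.{u} k) M)
    (F : QuantumBundle.ComoduleAlgebraSheaf k H M) (ι : O ⟶ F.sheaf)
    {I : Type*} [Finite I] (U : I → Opens M)
    (hF : QuantumBundle.IsQuantumPrincipalBundle O F ι U)
    (hM : M.str = TopologicalSpace.generateFrom (Set.range fun i => (U i : Set M)))
    (hU : ∀ i, (U i : Set M).Nonempty → ∃ x ∈ U i, ∀ j, x ∈ U j → U i ≤ U j)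
    (f : ∀ i, QuantumBundle.coinvH k J →ₐ[k]
      QuantumBundle.coinvariantCentralizer (F.coact (U i)))
    (hf : ∀ i, QuantumBundle.IsModuleComoduleMap J (F.coact (U i))
      (hF.principal i).galois (f i))
    (hglue : ∀ i j (x : QuantumBundle.coinvH k J),
      QuantumBundle.res F.sheaf (inf_le_left : U i ⊓ U j ≤ U i) (f i x) =
        QuantumBundle.res F.sheaf (inf_le_right : U i ⊓ U j ≤ U j) (f j x)) :
    ∃ (F₀ : QuantumBundle.ComoduleAlgebraSheaf k (H ⧸ J) M) (ι₀ : O ⟶ F₀.sheaf)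
      (φ : F.sheaf ⟶ F₀.sheaf),
      QuantumBundle.IsAlgebraicReduction J O F ι F₀ ι₀ φ U ∧
      ι ≫ φ = ι₀ ∧
      TopCat.Presheaf.IsLocallySurjective φ.hom ∧
      (∀ V, {a | QuantumBundle.appHom φ V a = 0} =
        QuantumBundle.locallyGeneratedIdeal F.sheaf U
          (fun i => QuantumBundle.augmentationImage (f i)) V) ∧
      (∀ i, Function.Surjective (QuantumBundle.appHom φ (U i)) ∧
        ∀ a, QuantumBundle.appHom φ (U i) a = 0 ↔
          a ∈ Ideal.span (QuantumBundle.augmentationImage (f i))) := by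
  have hS' : QuantumBundle.IsCoactionStable J F U fun i =>
      QuantumBundle.augmentationImage (f i) := by
    rintro i B _ _ π hπ _ ⟨x, hx, rfl⟩
    exact QuantumBundle.map_mk_coaction_eq_zero
      (g := (QuantumBundle.coinvariantCentralizer (F.coact (U i))).val.comp (f i))
      (hf i).map_coaction (fun y hy => hπ _ ⟨y, hy, rfl⟩) hx
  have hfin := QuantumBundle.finite_isMinimalNhd hM
  have hmin : ∀ (V : Opens M), ∀ x ∈ V,
      ∃ W, QuantumBundle.IsMinimalNhd W ∧ x ∈ W ∧ W ≤ V :=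
    fun V x hx => QuantumBundle.exists_isMinimalNhd hM hx
  have hglue' : ∀ i j, ∀ a ∈ QuantumBundle.augmentationImage (f i),
      ∃ b ∈ QuantumBundle.augmentationImage (f j),
        QuantumBundle.res F.sheaf (inf_le_left : U i ⊓ U j ≤ U i) a =
          QuantumBundle.res F.sheaf (inf_le_right : U i ⊓ U j ≤ U j) b := by
    rintro i j _ ⟨x, hx, rfl⟩
    exact ⟨f j x, ⟨x, hx, rfl⟩, hglue i j x⟩
  have hlocal : ∀ i, Function.Surjective (QuantumBundle.appHom (hS'.proj hfin) (U i)) ∧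
      ∀ a, QuantumBundle.appHom (hS'.proj hfin) (U i) a = 0 ↔
        a ∈ Ideal.span (QuantumBundle.augmentationImage (f i)) := by
    intro i
    -- The empty set is not a minimal neighbourhood, but all sections over it coincide and the claim
    -- is trivial.
    rcases Set.eq_empty_or_nonempty (U i : Set M) with he | hne
    · have hbot : U i = ⊥ := SetLike.coe_injective he
      have h₀ := QuantumBundle.subsingleton_of_eq_bot (hS'.quotientSheaf hfin).sheaf hbot
      have h₁ := QuantumBundle.subsingleton_of_eq_bot F.sheaf hbot
      refine ⟨fun s => ⟨0, Subsingleton.elim _ _⟩, fun a => iff_of_true (Subsingleton.elim _ _) ?_⟩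
      rw [Subsingleton.elim a 0]
      exact zero_mem _
    · have hi := QuantumBundle.isMinimalNhd_of_generates hM (hU i hne)
      refine ⟨hS'.proj_surjective_of_isMinimalNhd hfin hi, fun a => ?_⟩
      rw [hS'.proj_eq_zero_iff_of_isMinimalNhd hfin hglue' hi]
      exact QuantumBundle.span_augmentationImage_eq (hf i) a
  have hred := fun i => QuantumBundle.coinvariants_of_quotient hJ (hF.principal i)
    (g := (QuantumBundle.coinvariantCentralizer (F.coact (U i))).val.comp (f i))
    (hf i).map_coaction (hlocal i).1
    (fun x hx => ((hlocal i).2 _).2 (Ideal.subset_span ⟨x, hx, rfl⟩))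
    (fun a ha => ((hlocal i).2 a).1 ha) (hS'.proj_colinear hfin (U i))
  refine ⟨hS'.quotientSheaf hfin, ι ≫ hS'.proj hfin, hS'.proj hfin, ⟨hF, ?_, hS'.proj_colinear hfin,
    fun i => (hred i).1⟩, rfl, hS'.proj_isLocallySurjective hfin hmin,
    hS'.ker_proj hfin hF.cover hmin hglue', hlocal⟩
  refine ⟨hF.cover, fun V b => ?_, fun i => ?_, fun i => ?_, fun i => ?_⟩
  · have h1 : F.coact V (QuantumBundle.appHom ι V b) = _ := hF.mem_coinvariants V b
    refine (hS'.proj_colinear hfin V (QuantumBundle.appHom ι V b)).trans ?_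
    rw [h1]
    simp
    rfl
  · intro b b' h
    -- The projection is injective on coinvariants by faithful flatness, and the difference of the
    -- two images under `ι` is coinvariant.
    refine hF.injective i (sub_eq_zero.1 ((hred i).2 _ ?_ ?_))
    · exact sub_mem (hF.mem_coinvariants _ b) (hF.mem_coinvariants _ b')
    · exact (map_sub _ _ _).trans (sub_eq_zero.2 h)
  · rw [← (hred i).1, ← hF.range_eq i]
    exact AlgHom.range_comp _ _
  · exact QuantumBundle.IsPrincipal.of_quotient hJ (hF.principal i)
      (g := (QuantumBundle.coinvariantCentralizer (F.coact (U i))).val.comp (f i))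
      (hf i).map_coaction (hlocal i).1
      (fun x hx => ((hlocal i).2 _).2 (Ideal.subset_span ⟨x, hx, rfl⟩))
      (fun a ha => ((hlocal i).2 a).1 ha) (hS'.proj_colinear hfin (U i))
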